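/- Let $\mathcal{V}$ be a finite-dimensional real or complex vector space, let $\|\cdot\|$ be any norm on the vector space of linear endomorphisms of $\mathcal{V}$ (not assumed to be an operator norm or submultiplicative), and let $\mathcal{T}$ be a linear endomorphism of $\mathcal{V}$ with $\|\mathcal{T}^k\|\le C$ for all integers $k\ge0$. Eigenvalues, spectral projectors and linear factors of polynomials are always understood over $\mathbb{C}$, after complexification if $\mathcal{V}$ is real. Let $$\mathcal{T}_\infty=\sum_{|\lambda|=1}\lambda\,\mathcal{P}_\lambda,$$ where the sum is over the distinct eigenvalues $\lambda$ of $\mathcal{T}$ of magnitude one and $\mathcal{P}_\lambda$ is the projection onto the generalized eigenspace of $\lambda$ along the sum of the other generalized eigenspaces (if $\mathcal{V}$ is real, this sum maps $\mathcal{V}$ to itself, so $\mathcal{T}_\infty$ is an endomorphism of $\mathcal{V}$). Let $m$ be the minimal polynomial of $\mathcal{T}-\mathcal{T}_\infty$, let $|m|$ be its degree, i.e. the number of its linear factors counted with multiplicity, and let $\mu$ be the spectral radius of $\mathcal{T}-\mathcal{T}_\infty$. Assume that $\mu>0$ or $\mathcal{T}=\mathcal{T}_\infty$. Then, for every eigenvalue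 $\lambda_D$ of $\mathcal{T}-\mathcal{T}_\infty$ with $|\lambda_D|=\mu$ and every natural number $n>\frac{\mu}{1-\mu}$, $$\|\mathcal{T}^n-\mathcal{T}_\infty^n\|\le\mu^{n}\,\frac{4Ce^{2}\sqrt{|m|}\,(|m|+1)}{\left(1-(1+\frac1n)\mu\right)^{3/2}}\prod_{i}\frac{1-(1+\frac1n)\mu|\lambda_i|}{\mu-|\lambda_i|+\frac{\mu}{n}},$$ where the product is over the linear factors $z-\lambda_i$ of $m(z)/(z-\lambda_D)$, counted with multiplicity. -/

import Mathlib

open Polynomial TensorProduct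

noncomputable section

namespace PowerBounded

section Complex

variable {E : Type*} [AddCommGroup E] [Module ℂ E] [FiniteDimensional ℂ E]

/-- Sum of all generalized eigenspaces of `S` except the one belonging to `z`. -/
def otherGenEigenspaces (S : Module.End ℂ E) (z : ℂ) : Submodule ℂ E :=
  ⨆ w : ℂ, ⨆ _ : w ≠ z, S.maxGenEigenspace w

theorem isCompl_maxGenEigenspace (S : Module.End ℂ E) (z : ℂ) :
    IsCompl (S.maxGenEigenspace z) (otherGenEigenspaces S z) := by
  refine ⟨S.independent_maxGenEigenspace z, ?_⟩
  rw [codisjoint_iff, eq_top_iff, ← Module.End.iSup_maxGenEigenspace_eq_top S]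
  refine iSup_le fun w => ?_
  by_cases h : w = z
  · subst h
    exact le_sup_left
  · exact le_sup_of_le_right (le_iSup₂_of_le w h le_rfl)

/-- The spectral projector of `S` at `z`: the projection onto the generalized eigenspace of `z`
along the sum of all other generalized eigenspaces. -/
def spectralProjector (S : Module.End ℂ E) (z : ℂ) : Module.End ℂ E :=
  (S.maxGenEigenspace z).projection (otherGenEigenspaces S z) (isCompl_maxGenEigenspace S z)

theorem finite_peripheral (S : Module.End ℂ E) :
    {z : ℂ | S.HasEigenvalue z ∧ ‖z‖ = 1}.Finite :=
  S.finite_hasEigenvalue.subset fun _ h => h.1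

/-- The asymptotic part of an operator on a complex space: the sum of `z • P_z` over all distinct
eigenvalues `z` of magnitude one, where `P_z` is the spectral projector at `z`. -/
def asymptoticPart (S : Module.End ℂ E) : Module.End ℂ E :=
  ∑ z ∈ (finite_peripheral S).toFinset, z • spectralProjector S z

end Complex

section Real

variable {V : Type*} [AddCommGroup V] [Module ℝ V]

/-- The complex-linear extension of a real operator to the complexification of its space. -/
def complexify (T : Module.End ℝ V) : Module.End ℂ (ℂ ⊗[ℝ] V) :=
  T.baseChange ℂ

/-- The real part `a ⊗ v ↦ (re a) v` of a vector of the complexification. -/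
def rePart (V : Type*) [AddCommGroup V] [Module ℝ V] : ℂ ⊗[ℝ] V →ₗ[ℝ] V :=
  (TensorProduct.lid ℝ V).toLinearMap ∘ₗ LinearMap.rTensor V Complex.reLm

/-- The asymptotic part of an operator on a real space: the restriction to `V` of the asymptotic
part of the complexified operator. The latter maps `V` to itself, so taking the real part does not
lose anything, see `complexify_realAsymptoticPart`. -/
def realAsymptoticPart [FiniteDimensional ℝ V] (T : Module.End ℝ V) : Module.End ℝ V :=
  rePart V ∘ₗ (asymptoticPart (complexify T)).restrictScalars ℝ ∘ₗ
    (TensorProduct.mk ℝ ℂ V 1)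

/-- Complex conjugation on the complexification. -/
def conjVec (V : Type*) [AddCommGroup V] [Module ℝ V] : ℂ ⊗[ℝ] V →ₗ[ℝ] ℂ ⊗[ℝ] V :=
  LinearMap.rTensor V Complex.conjAe.toLinearMap

theorem conjVec_conjVec (x : ℂ ⊗[ℝ] V) : conjVec V (conjVec V x) = x := by
  induction x with
  | zero => simp
  | tmul a v => simp [conjVec]
  | add x y hx hy => simp [hx, hy]

theorem conjVec_smul (a : ℂ) (x : ℂ ⊗[ℝ] V) :
    conjVec V (a • x) = (starRingEnd ℂ a) • conjVec V x := by
  induction x with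
  | zero => simp
  | tmul b v => simp [conjVec, TensorProduct.smul_tmul']
  | add x y hx hy => simp [hx, hy]

theorem conjVec_complexify (T : Module.End ℝ V) (x : ℂ ⊗[ℝ] V) :
    conjVec V (complexify T x) = complexify T (conjVec V x) := by
  induction x with
  | zero => simp
  | tmul b v => simp [conjVec, complexify]
  | add x y hx hy => simp [hx, hy]

theorem conjVec_mem (T : Module.End ℝ V) (z : ℂ) {x : ℂ ⊗[ℝ] V}
    (hx : x ∈ (complexify T).maxGenEigenspace z) :
    conjVec V x ∈ (complexify T).maxGenEigenspace (starRingEnd ℂ z) := by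
  rw [Module.End.mem_maxGenEigenspace] at hx ⊢
  obtain ⟨k, hk⟩ := hx
  refine ⟨k, ?_⟩
  have key : ∀ (k : ℕ) (y : ℂ ⊗[ℝ] V),
      ((complexify T - (starRingEnd ℂ z) • (1 : Module.End ℂ (ℂ ⊗[ℝ] V))) ^ k) (conjVec V y)
        = conjVec V (((complexify T - z • (1 : Module.End ℂ (ℂ ⊗[ℝ] V))) ^ k) y) := by
    intro k
    induction k with
    | zero => intro y; simp
    | succ k ih =>
      intro y
      rw [pow_succ, pow_succ, Module.End.mul_apply, Module.End.mul_apply, ← ih]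
      congr 1
      simp [conjVec_smul, conjVec_complexify]
  rw [key, hk, map_zero]

theorem conjVec_mem_other (T : Module.End ℝ V) (z : ℂ) {x : ℂ ⊗[ℝ] V}
    (hx : x ∈ otherGenEigenspaces (complexify T) z) :
    conjVec V x ∈ otherGenEigenspaces (complexify T) (starRingEnd ℂ z) := by
  unfold otherGenEigenspaces at hx
  rw [iSup_subtype'] at hx
  induction hx using Submodule.iSup_induction' with
  | mem i y hy =>
    refine Submodule.mem_iSup_of_mem (starRingEnd ℂ i.1) (Submodule.mem_iSup_of_mem ?_
      (conjVec_mem T _ hy))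
    intro h
    exact i.2 ((starRingEnd ℂ).injective h)
  | zero => simp
  | add x y _ _ hx hy => rw [map_add]; exact Submodule.add_mem _ hx hy

theorem conjVec_spectralProjector [FiniteDimensional ℝ V] (T : Module.End ℝ V) (z : ℂ) (x : ℂ ⊗[ℝ] V) :
    conjVec V (spectralProjector (complexify T) z x)
      = spectralProjector (complexify T) (starRingEnd ℂ z) (conjVec V x) := by
  set S := complexify T
  have hc := isCompl_maxGenEigenspace S z
  have hc' := isCompl_maxGenEigenspace S (starRingEnd ℂ z)
  have h1 : conjVec V (spectralProjector S z x) ∈ S.maxGenEigenspace (starRingEnd ℂ z) :=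
    conjVec_mem T z (Submodule.projection_apply_mem hc x)
  have h2 : conjVec V (x - spectralProjector S z x) ∈ otherGenEigenspaces S (starRingEnd ℂ z) :=
    conjVec_mem_other T z (Submodule.sub_projection_mem hc x)
  have h3 : conjVec V x = conjVec V (spectralProjector S z x)
      + conjVec V (x - spectralProjector S z x) := by
    rw [← map_add, add_sub_cancel]
  rw [h3, map_add]
  have h4 := Submodule.projection_apply_of_mem_left hc' h1
  have h5 := (Submodule.projection_apply_eq_zero_iff hc').2 h2
  unfold spectralProjector at h4 h5 ⊢
  rw [h4, h5, add_zero]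

theorem hasEigenvalue_conj (T : Module.End ℝ V) {z : ℂ}
    (h : (complexify T).HasEigenvalue z) :
    (complexify T).HasEigenvalue (starRingEnd ℂ z) := by
  obtain ⟨x, hx⟩ := h.exists_hasEigenvector
  refine Module.End.hasEigenvalue_of_hasEigenvector (x := conjVec V x) ?_
  rw [Module.End.hasEigenvector_iff, Module.End.mem_eigenspace_iff] at hx ⊢
  refine ⟨?_, fun h0 => hx.2 ?_⟩
  · rw [← conjVec_complexify, hx.1, conjVec_smul]
  · rw [← conjVec_conjVec x, h0, map_zero]

theorem conjVec_asymptoticPart [FiniteDimensional ℝ V] (T : Module.End ℝ V) (x : ℂ ⊗[ℝ] V) :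
    conjVec V (asymptoticPart (complexify T) x)
      = asymptoticPart (complexify T) (conjVec V x) := by
  simp only [asymptoticPart, LinearMap.sum_apply, LinearMap.smul_apply, map_sum, conjVec_smul,
    conjVec_spectralProjector]
  refine Finset.sum_nbij' (fun z => starRingEnd ℂ z) (fun z => starRingEnd ℂ z) ?_ ?_ ?_ ?_ ?_
  · intro z hz
    simp only [Set.Finite.mem_toFinset, Set.mem_ofPred_eq] at hz ⊢
    exact ⟨hasEigenvalue_conj T hz.1, by simpa using hz.2⟩
  · intro z hz
    simp only [Set.Finite.mem_toFinset, Set.mem_ofPred_eq] at hz ⊢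
    exact ⟨hasEigenvalue_conj T hz.1, by simpa using hz.2⟩
  · intro z _; simp
  · intro z _; simp
  · intro z _; rfl

theorem one_tmul_rePart (x : ℂ ⊗[ℝ] V) :
    (1 : ℂ) ⊗ₜ[ℝ] rePart V x = (1 / 2 : ℝ) • (x + conjVec V x) := by
  induction x with
  | zero => simp
  | tmul a v =>
    simp only [rePart, conjVec, LinearMap.comp_apply, LinearMap.rTensor_tmul,
      LinearEquiv.coe_coe, TensorProduct.lid_tmul]
    rw [← TensorProduct.smul_tmul, ← TensorProduct.add_tmul, TensorProduct.smul_tmul']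
    congr 1
    apply Complex.ext <;> simp <;> ring
  | add x y hx hy =>
    rw [map_add, TensorProduct.tmul_add, hx, hy, map_add, ← smul_add]
    congr 1
    abel

/-- The complexification of `realAsymptoticPart T` is the asymptotic part of the complexification
of `T`, that is, the sum of `z • P_z` over its eigenvalues of magnitude one. -/
theorem complexify_realAsymptoticPart [FiniteDimensional ℝ V] (T : Module.End ℝ V) :
    complexify (realAsymptoticPart T) = asymptoticPart (complexify T) := by
  ext v
  have h := conjVec_asymptoticPart T ((1 : ℂ) ⊗ₜ[ℝ] v)
  have h1 : conjVec V ((1 : ℂ) ⊗ₜ[ℝ] v) = (1 : ℂ) ⊗ₜ[ℝ] v := by simp [conjVec]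
  rw [h1] at h
  simp only [TensorProduct.AlgebraTensorModule.curry_apply,
    TensorProduct.curry_apply, LinearMap.coe_restrictScalars]
  have h2 : ∀ S : Module.End ℝ V, complexify S ((1 : ℂ) ⊗ₜ[ℝ] v) = (1 : ℂ) ⊗ₜ[ℝ] S v :=
    fun S => by simp [complexify]
  rw [h2]
  simp only [realAsymptoticPart, LinearMap.comp_apply, TensorProduct.mk_apply,
    LinearMap.coe_restrictScalars]
  rw [one_tmul_rePart, h, ← two_smul ℝ, smul_smul]
  norm_num

end Real

/-- The upper bound
`μ ^ n * (4 C e² √|m| (|m| + 1)) / (1 - (1 + 1/n) μ) ^ (3/2)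
  * ∏ (1 - (1 + 1/n) μ |z|) / (μ - |z| + μ / n)`,
where `|m|` is the number of linear factors of `m` and the product is over the roots `z` of
`m / (X - lamD)`, with multiplicity. -/
def factorwiseBound (C μ : ℝ) (m : ℂ[X]) (lamD : ℂ) (n : ℕ) : ℝ :=
  μ ^ n *
    (4 * C * Real.exp 1 ^ 2 * Real.sqrt (m.natDegree : ℝ) * ((m.natDegree : ℝ) + 1) /
      (1 - (1 + 1 / (n : ℝ)) * μ) ^ (3 / 2 : ℝ)) *
    ((m /ₘ (X - Polynomial.C lamD)).roots.map fun z : ℂ =>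
      (1 - (1 + 1 / (n : ℝ)) * μ * ‖z‖) / (μ - ‖z‖ + μ / (n : ℝ))).prod

end PowerBounded

end

/-! Put `A = T - T'`, where `T'` is the asymptotic part. Power boundedness forbids Jordan blocks at
eigenvalues of modulus one, so `A T' = T' A = 0`, and hence `T ^ n - T' ^ n = A ^ n` for `n ≥ 1`.
The eigenvalues of modulus one form a point of a torus whose powers return arbitrarily close to the
identity. Thus powers of `T'` are limits of powers of `T`, obey the same bound `C`, and `N (A ^ k) ≤
2 C` (`WeaklyPowerBounded.seminorm_asymptoticPart_pow_le`).

A norming functional `φ` replaces `A ^ n` by the scalar sequence `a j = φ (A ^ j)`, which is bounded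
by `2 C` and satisfies the recurrence whose characteristic polynomial is `m`. This works for an
arbitrary norm, since submultiplicativity is never needed.

Let `B = ∑ β j z ^ j` be the Blaschke product with the roots of `m` as zeros. Applied to the shift,
`B` annihilates `a` at indices `l ≥ 0` (`tsum_blaschkeCoeff_mul_eq_zero`). Since `|B| = 1` on the
unit circle, correlating with the conjugate coefficients inverts `B` (`eq_tsum_conj_blaschkeCoeff`),
and in the resulting formula for `a n` only the terms with `i > n` survive. Therefore `|a n|` is at
most `(∑_{i > n} |β i|) (∑ |β j|) 2 C` (`norm_le_tail_blaschkeCoeff`).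

The full sum is controlled by Parseval and Cauchy–Schwarz on a circle slightly larger than the unit
circle (`tsum_norm_blaschkeCoeff_le_sqrt`). The tail is controlled by the total variation of `B` on
the circle of radius `1 / ρ`, with `ρ = (1 + 1/n) μ` (`tsum_tail_blaschkeCoeff_le`). -/

noncomputable section

namespace PowerBounded

/-! ### Absolutely convergent Fourier series on the circle. -/

section

open Complex MeasureTheory intervalIntegral

/-- The character `t ↦ exp (i j t)` of the circle. -/
def circleChar (j : ℤ) (t : ℝ) : ℂ := exp (j * t * I)

theorem circleChar_zero (t : ℝ) : circleChar 0 t = 1 := by simp [circleChar]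

theorem circleChar_add (j k : ℤ) (t : ℝ) :
    circleChar (j + k) t = circleChar j t * circleChar k t := by
  rw [circleChar, circleChar, circleChar, ← exp_add]; push_cast; ring_nf

theorem norm_circleChar (j : ℤ) (t : ℝ) : ‖circleChar j t‖ = 1 := by
  have : (j * t * I : ℂ) = ((j * t : ℝ) : ℂ) * I := by push_cast; ring
  rw [circleChar, this, norm_exp_ofReal_mul_I]

theorem conj_circleChar (j : ℤ) (t : ℝ) :
    (starRingEnd ℂ) (circleChar j t) = circleChar (-j) t := by
  rw [circleChar, circleChar, ← exp_conj]; simp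

theorem circleChar_eq_zpow (j : ℤ) (t : ℝ) : circleChar j t = circleChar 1 t ^ j := by
  rw [circleChar, circleChar, ← exp_int_mul]; push_cast; ring_nf

theorem hasDerivAt_circleChar (j : ℤ) (t : ℝ) :
    HasDerivAt (circleChar j) (j * I * circleChar j t) t := by
  have h : HasDerivAt (fun t : ℝ => (j * t * I : ℂ)) (j * I) t := by
    simpa using ((hasDerivAt_id t).ofReal_comp.const_mul (j : ℂ)).mul_const I
  have := h.cexp
  rw [mul_comm] at this
  exact this

@[fun_prop]
theorem continuous_circleChar (j : ℤ) : Continuous (circleChar j) := by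
  unfold circleChar; fun_prop

theorem circleChar_two_pi (j : ℤ) : circleChar j (2 * Real.pi) = 1 := by
  rw [circleChar]; push_cast
  rw [mul_assoc]; exact exp_int_mul_two_pi_mul_I j

theorem integral_circleChar (j : ℤ) :
    ∫ t in (0 : ℝ)..2 * Real.pi, circleChar j t = if j = 0 then 2 * Real.pi else 0 := by
  split_ifs with h
  · subst h; simp [circleChar_zero]
  · have hj : (j * I : ℂ) ≠ 0 := mul_ne_zero (by exact_mod_cast h) I_ne_zero
    have h1 : ∀ t ∈ Set.uIcc 0 (2 * Real.pi),
        HasDerivAt (fun t => (j * I : ℂ)⁻¹ * circleChar j t) (circleChar j t) t := by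
      intro t _
      have h2 := (hasDerivAt_circleChar j t).const_mul ((j * I : ℂ)⁻¹)
      rwa [← mul_assoc, inv_mul_cancel₀ hj, one_mul] at h2
    rw [integral_eq_sub_of_hasDerivAt h1 ((continuous_circleChar j).intervalIntegrable _ _),
      circleChar_two_pi]
    simp [circleChar]

/-- An absolutely convergent Fourier series may be integrated term by term against a continuous
function. -/
theorem hasSum_integral_fourier {x : ℤ → ℂ} (hx : Summable x) {F H : ℝ → ℂ}
    (hF : ∀ t, HasSum (fun j => x j * circleChar j t) (F t)) (hH : Continuous H) :
    HasSum (fun j => x j * ∫ t in (0 : ℝ)..2 * Real.pi, circleChar j t * H t)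
      (∫ t in (0 : ℝ)..2 * Real.pi, F t * H t) := by
  obtain ⟨K, hK⟩ := (isCompact_uIcc (a := (0 : ℝ)) (b := 2 * Real.pi)).exists_bound_of_continuousOn
    hH.continuousOn
  have := intervalIntegral.hasSum_integral_of_dominated_convergence (μ := volume)
    (a := 0) (b := 2 * Real.pi)
    (F := fun (j : ℤ) t => x j * circleChar j t * H t) (f := fun t => F t * H t)
    (fun j _ => ‖x j‖ * K)
    (fun j => (by fun_prop : Continuous _).aestronglyMeasurable)
    (fun j => .of_forall fun t ht => by
      rw [norm_mul, norm_mul, norm_circleChar, mul_one]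
      exact mul_le_mul_of_nonneg_left (hK t (Set.uIoc_subset_uIcc ht)) (norm_nonneg _))
    (.of_forall fun t _ => hx.norm.mul_right K)
    (by simp)
    (.of_forall fun t _ => (hF t).mul_right (H t))
  simpa [mul_assoc, intervalIntegral.integral_const_mul] using this

theorem integral_fourier_mul_char {x : ℤ → ℂ} (hx : Summable x) {F : ℝ → ℂ}
    (hF : ∀ t, HasSum (fun j => x j * circleChar j t) (F t)) (k : ℤ) :
    ∫ t in (0 : ℝ)..2 * Real.pi, F t * circleChar (-k) t = x k * (2 * Real.pi) := by
  refine (hasSum_integral_fourier hx hF (continuous_circleChar (-k))).unique ?_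
  simp only [← circleChar_add, integral_circleChar]
  convert hasSum_ite_eq k (x k * (2 * Real.pi) : ℂ) using 2 with j
  by_cases h : j = k
  · simp [h]
  · simp [h, add_neg_eq_zero]

/-- Parseval's identity for the autocorrelation of an absolutely convergent Fourier series. -/
theorem hasSum_autocorrelation {x : ℤ → ℂ} (hx : Summable x) {F : ℝ → ℂ} (hFc : Continuous F)
    (hF : ∀ t, HasSum (fun j => x j * circleChar j t) (F t)) (l : ℤ) :
    HasSum (fun i => x i * (starRingEnd ℂ) (x (i + l)) * (2 * Real.pi))
      (∫ t in (0 : ℝ)..2 * Real.pi, F t * (starRingEnd ℂ (F t) * circleChar l t)) := by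
  have h := hasSum_integral_fourier hx hF
    (H := fun t => starRingEnd ℂ (F t) * circleChar l t) (by fun_prop)
  convert h using 2 with j
  have h2 := congrArg (starRingEnd ℂ) (integral_fourier_mul_char hx hF (j + l))
  rw [← intervalIntegral_conj] at h2
  simp only [map_mul, conj_circleChar, neg_neg, conj_ofReal, map_ofNat] at h2
  rw [mul_assoc, ← h2]
  congr 2 with t
  rw [circleChar_add]; ring

theorem hasSum_norm_sq {x : ℤ → ℂ} (hx : Summable x) {F : ℝ → ℂ} (hFc : Continuous F)
    (hF : ∀ t, HasSum (fun j => x j * circleChar j t) (F t)) :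
    HasSum (fun i => ‖x i‖ ^ 2 * (2 * Real.pi)) (∫ t in (0 : ℝ)..2 * Real.pi, ‖F t‖ ^ 2) := by
  have h := hasSum_autocorrelation hx hFc hF 0
  rw [← Complex.hasSum_ofReal, ← intervalIntegral.integral_ofReal]
  convert h using 3 with i t
  · simp [mul_conj, normSq_eq_norm_sq]
  · simp [circleChar_zero, mul_conj, normSq_eq_norm_sq]

end

/-! ### Blaschke products on circles and their Taylor coefficients. -/

section

open Complex MeasureTheory intervalIntegral

/-- The Blaschke factor vanishing at `w`. -/
def blaschkeFactor (w z : ℂ) : ℂ := (z - w) / (1 - starRingEnd ℂ w * z)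

/-- The finite Blaschke product with zeros `s`, counted with multiplicity. -/
def blaschke (s : Multiset ℂ) (z : ℂ) : ℂ := (s.map fun w => blaschkeFactor w z).prod

/-- The Taylor coefficients at `0` of a Blaschke product, extended by zero to negative indices. -/
def blaschkeCoeff (s : Multiset ℂ) : ℤ → ℂ :=
  Function.extend (Nat.cast : ℕ → ℤ)
    (fun j : ℕ => (j.factorial : ℂ)⁻¹ * iteratedDeriv j (blaschke s) 0) 0

@[simp]
theorem blaschke_zero (z : ℂ) : blaschke 0 z = 1 := by simp [blaschke]

@[simp]
theorem blaschke_cons (w : ℂ) (s : Multiset ℂ) (z : ℂ) :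
    blaschke (w ::ₘ s) z = blaschkeFactor w z * blaschke s z := by simp [blaschke]

theorem blaschkeCoeff_neg (s : Multiset ℂ) {j : ℤ} (hj : j < 0) : blaschkeCoeff s j = 0 := by
  rw [blaschkeCoeff, Function.extend_apply']
  · rfl
  · rintro ⟨k, rfl⟩; omega

theorem one_sub_conj_mul_ne_zero {w z : ℂ} (h : ‖w‖ * ‖z‖ < 1) :
    1 - starRingEnd ℂ w * z ≠ 0 := by
  intro h0
  have : ‖starRingEnd ℂ w * z‖ = 1 := by rw [← sub_eq_zero.1 h0, norm_one]
  rw [norm_mul, RCLike.norm_conj] at this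
  linarith

theorem differentiableAt_blaschke {s : Multiset ℂ} {z : ℂ} (h : ∀ w ∈ s, ‖w‖ * ‖z‖ < 1) :
    DifferentiableAt ℂ (blaschke s) z := by
  induction s using Multiset.induction_on with
  | empty => simp [funext blaschke_zero]
  | cons w s ih =>
    simp only [Multiset.mem_cons, forall_eq_or_imp] at h
    have h1 := ih h.2
    have h2 := one_sub_conj_mul_ne_zero h.1
    rw [funext (blaschke_cons w s)]
    unfold blaschkeFactor
    fun_prop (disch := assumption)

theorem hasSum_blaschke {s : Multiset ℂ} {R : ℝ} (hR0 : 0 < R) (hR : ∀ w ∈ s, ‖w‖ * R < 1)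
    (t : ℝ) :
    HasSum (fun j : ℤ => blaschkeCoeff s j * (R : ℂ) ^ j * circleChar j t)
      (blaschke s (R * circleChar 1 t)) := by
  -- The strict inequalities leave room for a larger pole-free open disc, which contains the circle
  -- of radius `R`.
  obtain ⟨r, hRr, hr⟩ : ∃ r > R, ∀ w ∈ s, ‖w‖ * r < 1 := by
    have h : ∀ᶠ r in nhdsWithin R (Set.Ioi R), ∀ w ∈ s.toFinset, ‖w‖ * r < 1 := by
      rw [Filter.eventually_all_finset]
      intro w hw
      have : ContinuousAt (fun r => ‖w‖ * r) R := by fun_prop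
      exact (this.eventually_lt continuousAt_const (hR w (by simpa using hw))).filter_mono
        nhdsWithin_le_nhds
    obtain ⟨r, h1, h2⟩ := (h.and self_mem_nhdsWithin).exists
    exact ⟨r, h2, by simpa using h1⟩
  have hd : DifferentiableOn ℂ (blaschke s) (Metric.ball 0 r) := fun z hz =>
    (differentiableAt_blaschke fun w hw => lt_of_le_of_lt
      (mul_le_mul_of_nonneg_left (by simpa using (mem_ball_zero_iff.1 hz).le) (norm_nonneg w))
        (hr w hw)).differentiableWithinAt
  have hz : (R * circleChar 1 t : ℂ) ∈ Metric.ball 0 r := by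
    simpa [norm_circleChar, abs_of_pos hR0] using hRr
  have h := hasSum_taylorSeries_on_ball hd hz
  rw [← Function.Injective.hasSum_iff (g := (Nat.cast : ℕ → ℤ)) Nat.cast_injective]
  · refine (congrArg (HasSum · _) (funext fun j => ?_)).mpr h
    simp only [Function.comp_apply, blaschkeCoeff, Nat.cast_injective.extend_apply, sub_zero,
      smul_eq_mul, zpow_natCast]
    rw [circleChar_eq_zpow, zpow_natCast, mul_pow]; ring
  · intro j hj
    rw [blaschkeCoeff_neg, zero_mul, zero_mul]
    by_contra! h0
    exact hj ⟨j.toNat, by omega⟩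

theorem summable_blaschkeCoeff {s : Multiset ℂ} {R : ℝ} (hR0 : 0 < R)
    (hR : ∀ w ∈ s, ‖w‖ * R < 1) :
    Summable (fun j : ℤ => blaschkeCoeff s j * (R : ℂ) ^ j) := by
  have := (hasSum_blaschke hR0 hR 0).summable
  simpa [circleChar] using this

theorem continuous_blaschke_circle {s : Multiset ℂ} {R : ℝ} (hR0 : 0 < R)
    (hR : ∀ w ∈ s, ‖w‖ * R < 1) : Continuous fun t : ℝ => blaschke s (R * circleChar 1 t) := by
  rw [continuous_iff_continuousAt]
  intro t
  have h : ContinuousAt (blaschke s) (R * circleChar 1 t) :=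
    (differentiableAt_blaschke fun w hw => by
      simpa [norm_circleChar, abs_of_pos hR0] using hR w hw).continuousAt
  exact h.comp (f := fun t : ℝ => (R * circleChar 1 t : ℂ)) (by fun_prop)

/-- On `|z| = R` the squared modulus is `1 + (R² - 1)(1 - |w|²) / |1 - conj w z|²`, which is largest
where `Re (conj w z)` reaches its maximum `|w| R`. -/
theorem norm_blaschkeFactor_le {w z : ℂ} {R : ℝ} (hR : 1 ≤ R) (hw : ‖w‖ * R < 1) (hz : ‖z‖ = R) :
    ‖blaschkeFactor w z‖ ≤ (R - ‖w‖) / (1 - ‖w‖ * R) := by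
  have h0 := norm_nonneg w
  have hw1 : ‖w‖ < 1 := by nlinarith
  have hne := one_sub_conj_mul_ne_zero (w := w) (z := z) (by rwa [hz])
  rw [blaschkeFactor, norm_div, div_le_div_iff₀ (norm_pos_iff.2 hne) (by linarith)]
  refine le_of_sq_le_sq ?_ (by have := norm_nonneg (1 - starRingEnd ℂ w * z); nlinarith)
  have e1 : ‖z - w‖ ^ 2 = R ^ 2 - 2 * (starRingEnd ℂ w * z).re + ‖w‖ ^ 2 := by
    rw [← hz, ← normSq_eq_norm_sq, ← normSq_eq_norm_sq, ← normSq_eq_norm_sq, normSq_sub]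
    rw [mul_comm z]; ring
  have e2 : ‖1 - starRingEnd ℂ w * z‖ ^ 2 =
      1 - 2 * (starRingEnd ℂ w * z).re + ‖w‖ ^ 2 * R ^ 2 := by
    rw [← hz, ← normSq_eq_norm_sq, ← normSq_eq_norm_sq, ← normSq_eq_norm_sq, normSq_sub]
    simp; ring
  have e3 : (starRingEnd ℂ w * z).re ≤ ‖w‖ * R := by
    refine (re_le_norm _).trans ?_
    rw [norm_mul, RCLike.norm_conj, hz]
  rw [mul_pow, mul_pow, e1, e2]
  have h1 : 0 ≤ (‖w‖ * R - (starRingEnd ℂ w * z).re) * ((R ^ 2 - 1) * (1 - ‖w‖ ^ 2)) :=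
    mul_nonneg (by linarith) (mul_nonneg (by nlinarith) (by nlinarith))
  nlinarith

/-- The product of the maxima of the Blaschke factors on the circle of radius `R ≥ 1`. -/
def blaschkeMax (s : Multiset ℂ) (R : ℝ) : ℝ :=
  (s.map fun w : ℂ => (R - ‖w‖) / (1 - ‖w‖ * R)).prod

theorem blaschkeMax_nonneg {s : Multiset ℂ} {R : ℝ} (hR1 : 1 ≤ R) (hR : ∀ w ∈ s, ‖w‖ * R < 1) :
    0 ≤ blaschkeMax s R := by
  refine Multiset.prod_nonneg fun x hx => ?_
  obtain ⟨w, hw, rfl⟩ := Multiset.mem_map.1 hx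
  have := hR w hw
  have h0 := norm_nonneg w
  exact div_nonneg (by nlinarith) (by linarith)

theorem norm_blaschke_le {s : Multiset ℂ} {z : ℂ} {R : ℝ} (hR1 : 1 ≤ R)
    (hR : ∀ w ∈ s, ‖w‖ * R < 1) (hz : ‖z‖ = R) : ‖blaschke s z‖ ≤ blaschkeMax s R := by
  induction s using Multiset.induction_on with
  | empty => simp [blaschkeMax]
  | cons w s ih =>
    simp only [Multiset.mem_cons, forall_eq_or_imp] at hR
    rw [blaschke_cons, norm_mul, blaschkeMax, Multiset.map_cons, Multiset.prod_cons]
    exact mul_le_mul (norm_blaschkeFactor_le hR1 hR.1 hz) (ih hR.2) (norm_nonneg _)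
      ((norm_nonneg _).trans (norm_blaschkeFactor_le hR1 hR.1 hz))

/-- On the unit circle `1 - conj w z = conj (z - w) z`, so each factor is unimodular. -/
theorem norm_blaschke_eq_one {s : Multiset ℂ} {z : ℂ} (hs : ∀ w ∈ s, ‖w‖ < 1) (hz : ‖z‖ = 1) :
    ‖blaschke s z‖ = 1 := by
  induction s using Multiset.induction_on with
  | empty => simp
  | cons w s ih =>
    simp only [Multiset.mem_cons, forall_eq_or_imp] at hs
    rw [blaschke_cons, norm_mul, ih hs.2, mul_one, blaschkeFactor, norm_div]
    have hne := one_sub_conj_mul_ne_zero (w := w) (z := z) (by rw [hz]; linarith [hs.1])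
    rw [div_eq_one_iff_eq (norm_ne_zero_iff.2 hne)]
    have h1 : 1 - starRingEnd ℂ w * z = starRingEnd ℂ (z - w) * z := by
      have : starRingEnd ℂ z * z = 1 := by
        rw [mul_comm, mul_conj, normSq_eq_norm_sq, hz]; simp
      rw [map_sub, sub_mul, this]
    rw [h1, norm_mul, hz, mul_one, RCLike.norm_conj]

/-- Parseval for the geometric series. It evaluates the length of the image of a circle under a
Blaschke factor. -/
theorem integral_norm_sq_inv {w : ℂ} {R : ℝ} (hR0 : 0 < R) (hw : ‖w‖ * R < 1) :
    ∫ t in (0 : ℝ)..2 * Real.pi, ‖(1 - starRingEnd ℂ w * (R * circleChar 1 t))⁻¹‖ ^ 2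
      = 2 * Real.pi / (1 - ‖w‖ ^ 2 * R ^ 2) := by
  have hnorm : ∀ t, ‖starRingEnd ℂ w * (R * circleChar 1 t)‖ = ‖w‖ * R := fun t => by
    simp [norm_circleChar, abs_of_pos hR0]
  have hn : ‖starRingEnd ℂ w * R‖ < 1 := by simpa [abs_of_pos hR0] using hw
  set x : ℤ → ℂ := Function.extend (Nat.cast : ℕ → ℤ) (fun j => (starRingEnd ℂ w * R) ^ j) 0
  have hx0 : ∀ j ∉ Set.range (Nat.cast : ℕ → ℤ), x j = 0 := fun j hj => by
    exact Function.extend_apply' _ _ _ hj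
  have hxn : ∀ j : ℕ, x j = (starRingEnd ℂ w * R) ^ j := fun j =>
    Nat.cast_injective.extend_apply _ _ _
  have hx : Summable x := by
    rw [← Function.Injective.summable_iff Nat.cast_injective hx0]
    simpa [Function.comp_def, hxn] using summable_geometric_of_norm_lt_one hn
  have hF : ∀ t, HasSum (fun j => x j * circleChar j t)
      (1 - starRingEnd ℂ w * (R * circleChar 1 t))⁻¹ := fun t => by
    rw [← Function.Injective.hasSum_iff (g := (Nat.cast : ℕ → ℤ)) Nat.cast_injective
      (fun j hj => by rw [hx0 j hj, zero_mul])]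
    refine (congrArg (HasSum · _) (funext fun j => ?_)).mpr
      (hasSum_geometric_of_norm_lt_one ((hnorm t).trans_lt hw))
    rw [Function.comp_apply, hxn, circleChar_eq_zpow, zpow_natCast, ← mul_pow, mul_assoc]
  have hc : Continuous fun t : ℝ => (1 - starRingEnd ℂ w * (R * circleChar 1 t))⁻¹ := by
    refine Continuous.inv₀ (by fun_prop) fun t => one_sub_conj_mul_ne_zero ?_
    simpa [norm_circleChar, abs_of_pos hR0] using hw
  refine (hasSum_norm_sq hx hc hF).unique ?_
  rw [← Function.Injective.hasSum_iff (g := (Nat.cast : ℕ → ℤ)) Nat.cast_injective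
      (fun j hj => by simp [hx0 j hj])]
  have h2 : ‖w‖ ^ 2 * R ^ 2 < 1 := by
    rw [← mul_pow]; exact pow_lt_one₀ (by positivity) hw two_ne_zero
  rw [div_eq_inv_mul]
  refine (congrArg (HasSum · _) (funext fun j => ?_)).mpr
    ((hasSum_geometric_of_lt_one (by positivity) h2).mul_right (2 * Real.pi))
  simp only [Function.comp_apply, hxn]
  rw [norm_pow, norm_mul, RCLike.norm_conj, norm_real, Real.norm_eq_abs, abs_of_pos hR0]; ring

/-- The derivative has modulus `R (1 - |w|²) / |1 - conj w z|²`, whose integral is known exactly.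
Weakening it to the maximum of the factor makes the bound multiplicative under the product rule. -/
theorem exists_hasDerivAt_blaschkeFactor_circle {w : ℂ} {R : ℝ} (hR1 : 1 ≤ R)
    (hw : ‖w‖ * R < 1) :
    ∃ f' : ℝ → ℂ, Continuous f' ∧
      (∀ t : ℝ, HasDerivAt (fun t : ℝ => blaschkeFactor w (R * circleChar 1 t)) (f' t) t) ∧
      ∫ t in (0 : ℝ)..2 * Real.pi, ‖f' t‖ ≤ 2 * Real.pi * ((R - ‖w‖) / (1 - ‖w‖ * R)) := by
  have hR0 : 0 < R := by linarith
  have hne : ∀ t, 1 - starRingEnd ℂ w * (R * circleChar 1 t) ≠ 0 := fun t =>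
    one_sub_conj_mul_ne_zero (by simpa [norm_circleChar, abs_of_pos hR0] using hw)
  have h0 := norm_nonneg w
  have hw1 : ‖w‖ < 1 := by nlinarith
  refine ⟨fun t => ((R * (1 - ‖w‖ ^ 2) : ℝ) : ℂ) *
    (1 - starRingEnd ℂ w * (R * circleChar 1 t))⁻¹ ^ 2 * (I * circleChar 1 t), ?_, fun t => ?_, ?_⟩
  · have hc : Continuous fun t : ℝ => (1 - starRingEnd ℂ w * (R * circleChar 1 t))⁻¹ :=
      Continuous.inv₀ (by fun_prop) hne
    fun_prop
  · have h1 : HasDerivAt (fun t : ℝ => (R * circleChar 1 t : ℂ)) (R * (I * circleChar 1 t)) t := by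
      simpa using (hasDerivAt_circleChar 1 t).const_mul (R : ℂ)
    have h2 := (h1.sub_const w).div ((h1.const_mul (starRingEnd ℂ w)).const_sub 1) (hne t)
    refine h2.congr_deriv (Eq.symm ?_)
    have e : ((‖w‖ ^ 2 : ℝ) : ℂ) = w * starRingEnd ℂ w := by
      rw [mul_conj, normSq_eq_norm_sq]
    have h3 := hne t
    beta_reduce
    rw [inv_pow, ← div_eq_mul_inv, div_mul_eq_mul_div, ofReal_mul, ofReal_sub, e]
    congr 1
    push_cast
    ring
  · have e : ∀ t, ‖((R * (1 - ‖w‖ ^ 2) : ℝ) : ℂ) *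
        (1 - starRingEnd ℂ w * (R * circleChar 1 t))⁻¹ ^ 2 * (I * circleChar 1 t)‖
        = R * (1 - ‖w‖ ^ 2) * ‖(1 - starRingEnd ℂ w * (R * circleChar 1 t))⁻¹‖ ^ 2 := fun t => by
      rw [norm_mul, norm_mul, norm_mul, norm_circleChar, norm_I, norm_pow, norm_real,
        Real.norm_of_nonneg (mul_nonneg hR0.le (by nlinarith))]
      ring
    simp_rw [e]
    rw [intervalIntegral.integral_const_mul, integral_norm_sq_inv hR0 hw]
    have h2 : 0 < 1 - ‖w‖ ^ 2 * R ^ 2 := by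
      rw [← mul_pow, sub_pos]; exact pow_lt_one₀ (by positivity) hw two_ne_zero
    rw [mul_div_assoc', mul_div_assoc', div_le_div_iff₀ h2 (by linarith)]
    -- This is the exact difference of the two sides after cross-multiplication.
    have h3 : 0 ≤ 2 * Real.pi * (1 - ‖w‖ * R) * (‖w‖ * (R ^ 2 - 1)) :=
      mul_nonneg (mul_nonneg (by positivity) (by linarith)) (mul_nonneg h0 (by nlinarith))
    nlinarith [h3]

/-- By the product rule, each of the `s.card` summands contributes at most `2π` times the product of
all the maxima. -/
theorem exists_hasDerivAt_blaschke_circle {s : Multiset ℂ} {R : ℝ} (hR1 : 1 ≤ R)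
    (hR : ∀ w ∈ s, ‖w‖ * R < 1) :
    ∃ F' : ℝ → ℂ, Continuous F' ∧
      (∀ t : ℝ, HasDerivAt (fun t : ℝ => blaschke s (R * circleChar 1 t)) (F' t) t) ∧
      ∫ t in (0 : ℝ)..2 * Real.pi, ‖F' t‖ ≤ 2 * Real.pi * (s.card * blaschkeMax s R) := by
  have hR0 : 0 < R := by linarith
  induction s using Multiset.induction_on with
  | empty => exact ⟨0, continuous_const, fun t => by simpa using hasDerivAt_const t (1 : ℂ), by simp⟩
  | cons w s ih =>
    simp only [Multiset.mem_cons, forall_eq_or_imp] at hR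
    obtain ⟨F', hFc, hFd, hFi⟩ := ih hR.2
    obtain ⟨f', hfc, hfd, hfi⟩ := exists_hasDerivAt_blaschkeFactor_circle hR1 hR.1
    have hfc0 : Continuous fun t : ℝ => blaschkeFactor w (R * circleChar 1 t) :=
      continuous_iff_continuousAt.2 fun t => (hfd t).continuousAt
    have hFc0 := continuous_blaschke_circle hR0 hR.2
    have hz : ∀ t, ‖(R * circleChar 1 t : ℂ)‖ = R := fun t => by
      simp [norm_circleChar, abs_of_pos hR0]
    refine ⟨fun t => f' t * blaschke s (R * circleChar 1 t)
      + blaschkeFactor w (R * circleChar 1 t) * F' t, by fun_prop, fun t => ?_, ?_⟩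
    · simp only [blaschke_cons]
      exact (hfd t).mul (hFd t)
    · set M := (R - ‖w‖) / (1 - ‖w‖ * R)
      have hM : blaschkeMax (w ::ₘ s) R = M * blaschkeMax s R := by
        simp [blaschkeMax, M]
      have hM0 : 0 ≤ M := (norm_nonneg _).trans (norm_blaschkeFactor_le hR1 hR.1 (hz 0))
      have hP0 := blaschkeMax_nonneg hR1 hR.2
      have h1 : ∫ t in (0 : ℝ)..2 * Real.pi, ‖f' t * blaschke s (R * circleChar 1 t)
          + blaschkeFactor w (R * circleChar 1 t) * F' t‖
          ≤ ∫ t in (0 : ℝ)..2 * Real.pi, (‖f' t‖ * blaschkeMax s R + M * ‖F' t‖) := by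
        refine integral_mono_on (by positivity)
          (Continuous.intervalIntegrable (by fun_prop) _ _)
          (Continuous.intervalIntegrable (by fun_prop) _ _) fun t _ => ?_
        refine (norm_add_le _ _).trans ?_
        rw [norm_mul, norm_mul]
        gcongr
        · exact norm_blaschke_le hR1 hR.2 (hz t)
        · exact norm_blaschkeFactor_le hR1 hR.1 (hz t)
      refine h1.trans ?_
      rw [integral_add (Continuous.intervalIntegrable (by fun_prop) _ _)
          (Continuous.intervalIntegrable (by fun_prop) _ _),
        intervalIntegral.integral_mul_const, intervalIntegral.integral_const_mul, hM,
        Multiset.card_cons]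
      have h2 := mul_le_mul_of_nonneg_right hfi hP0
      have h3 := mul_le_mul_of_nonneg_left hFi hM0
      push_cast
      nlinarith [h2, h3]

/-- Decay of the Taylor coefficients of a Blaschke product. -/
theorem norm_blaschkeCoeff_mul_le {s : Multiset ℂ} {R : ℝ} (hR1 : 1 ≤ R)
    (hR : ∀ w ∈ s, ‖w‖ * R < 1) (N : ℕ) :
    N * (‖blaschkeCoeff s N‖ * R ^ N) ≤ s.card * blaschkeMax s R := by
  have hR0 : 0 < R := by linarith
  obtain ⟨F', hFc, hFd, hFi⟩ := exists_hasDerivAt_blaschke_circle hR1 hR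
  have h1 := integral_fourier_mul_char (summable_blaschkeCoeff hR0 hR) (hasSum_blaschke hR0 hR) N
  -- Integration by parts against the character yields the factor `N`; the boundary terms cancel by
  -- periodicity.
  have h2 := integral_mul_deriv_eq_deriv_mul (a := 0) (b := 2 * Real.pi)
    (fun t _ => hFd t) (fun t _ => hasDerivAt_circleChar (-N) t)
    (hFc.intervalIntegrable _ _) (Continuous.intervalIntegrable (by fun_prop) _ _)
  have h3 : ∫ t in (0 : ℝ)..2 * Real.pi, blaschke s (R * circleChar 1 t) *
      (((-N : ℤ) : ℂ) * I * circleChar (-N) t)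
      = ((-N : ℤ) : ℂ) * I * (blaschkeCoeff s N * (R : ℂ) ^ (N : ℤ) * (2 * Real.pi)) := by
    rw [← h1, ← intervalIntegral.integral_const_mul]
    congr 1 with t; ring
  rw [h3, circleChar_two_pi, circleChar_two_pi] at h2
  have h4 : ∀ j, circleChar j 0 = 1 := fun j => by simp [circleChar]
  rw [h4, h4, sub_self, zero_sub] at h2
  have h5 := congrArg norm h2
  rw [norm_neg] at h5
  have h6 : ‖∫ t in (0 : ℝ)..2 * Real.pi, F' t * circleChar (-N) t‖
      ≤ ∫ t in (0 : ℝ)..2 * Real.pi, ‖F' t‖ := by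
    refine (intervalIntegral.norm_integral_le_integral_norm (by positivity)).trans_eq ?_
    simp [norm_circleChar]
  rw [← h5] at h6
  have h7 := h6.trans hFi
  simp only [norm_mul, norm_I, norm_pow, norm_real, Real.norm_of_nonneg hR0.le,
    Real.norm_of_nonneg Real.pi_pos.le, Int.cast_neg, norm_neg, Int.cast_natCast,
    Complex.norm_natCast, RCLike.norm_ofNat, zpow_natCast, mul_one] at h7
  have h8 : 0 < 2 * Real.pi := by positivity
  refine le_of_mul_le_mul_left ?_ h8
  linarith

theorem summable_and_tsum_norm_sq_blaschkeCoeff_le {s : Multiset ℂ} {R : ℝ} (hR1 : 1 ≤ R)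
    (hR : ∀ w ∈ s, ‖w‖ * R < 1) :
    Summable (fun j : ℤ => (‖blaschkeCoeff s j‖ * R ^ j) ^ 2) ∧
    ∑' j : ℤ, (‖blaschkeCoeff s j‖ * R ^ j) ^ 2 ≤ blaschkeMax s R ^ 2 := by
  have hR0 : 0 < R := by linarith
  have hp : 0 < 2 * Real.pi := by positivity
  have h1 := hasSum_norm_sq (summable_blaschkeCoeff hR0 hR) (continuous_blaschke_circle hR0 hR)
    (hasSum_blaschke hR0 hR)
  have h2 : ∫ t in (0 : ℝ)..2 * Real.pi, ‖blaschke s (R * circleChar 1 t)‖ ^ 2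
      ≤ ∫ t in (0 : ℝ)..2 * Real.pi, blaschkeMax s R ^ 2 := by
    have := continuous_blaschke_circle hR0 hR
    refine integral_mono_on (by positivity) (Continuous.intervalIntegrable (by fun_prop) _ _)
      (by simp) fun t _ => ?_
    have := norm_blaschke_le (z := R * circleChar 1 t) hR1 hR
      (by simp [norm_circleChar, abs_of_pos hR0])
    gcongr
  have h3 := h1.mul_right (2 * Real.pi)⁻¹
  simp only [mul_inv_cancel_right₀ hp.ne', norm_mul, norm_zpow, norm_real,
    Real.norm_of_nonneg hR0.le] at h3
  refine ⟨h3.summable, ?_⟩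
  rw [h3.tsum_eq, mul_inv_le_iff₀ hp]
  simpa [mul_comm] using h2

/-- The translates of the coefficient sequence of a Blaschke product are orthonormal. -/
theorem hasSum_autocorrelation_blaschkeCoeff {s : Multiset ℂ} (hs : ∀ w ∈ s, ‖w‖ < 1) (l : ℤ) :
    HasSum (fun i => blaschkeCoeff s i * starRingEnd ℂ (blaschkeCoeff s (i + l)))
      (if l = 0 then 1 else 0) := by
  have hs' : ∀ w ∈ s, ‖w‖ * 1 < 1 := by simpa using hs
  have hp : (2 * Real.pi : ℂ) ≠ 0 := by simp [Real.pi_ne_zero]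
  have h := (hasSum_autocorrelation (summable_blaschkeCoeff one_pos hs')
    (continuous_blaschke_circle one_pos hs') (hasSum_blaschke one_pos hs') l).mul_right
      (2 * Real.pi : ℂ)⁻¹
  -- Since `|B| = 1` on the unit circle, the autocorrelation integral reduces to that of a single
  -- character.
  have e : ∀ t, blaschke s ((1 : ℝ) * circleChar 1 t) *
      (starRingEnd ℂ (blaschke s ((1 : ℝ) * circleChar 1 t)) * circleChar l t) = circleChar l t :=
    fun t => by
      rw [← mul_assoc, mul_conj, normSq_eq_norm_sq, norm_blaschke_eq_one hs]
      · simp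
      · simp [norm_circleChar]
  simp only [e, integral_circleChar, mul_inv_cancel_right₀ hp] at h
  have e2 : ((if l = 0 then 2 * Real.pi else 0 : ℝ) : ℂ) * (2 * Real.pi : ℂ)⁻¹
      = if l = 0 then 1 else 0 := by
    split_ifs
    · push_cast; exact mul_inv_cancel₀ hp
    · simp
  rw [e2] at h
  simpa using h

/-- The functional equation `(1 - conj w * z) B_{w, s} = (z - w) B_s` in terms of coefficients. -/
theorem blaschkeCoeff_cons {w : ℂ} {s : Multiset ℂ} (hw : ‖w‖ < 1) (hs : ∀ w ∈ s, ‖w‖ < 1)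
    (j : ℤ) :
    blaschkeCoeff (w ::ₘ s) j - starRingEnd ℂ w * blaschkeCoeff (w ::ₘ s) (j - 1)
      = blaschkeCoeff s (j - 1) - w * blaschkeCoeff s j := by
  have hs1 : ∀ w ∈ s, ‖w‖ * 1 < 1 := by simpa using hs
  have hs2 : ∀ w' ∈ w ::ₘ s, ‖w'‖ * 1 < 1 := by
    simpa using ⟨hw, hs⟩
  have hp : (2 * Real.pi : ℂ) ≠ 0 := by simp [Real.pi_ne_zero]
  have h1 := integral_fourier_mul_char (summable_blaschkeCoeff one_pos hs1)
    (hasSum_blaschke one_pos hs1)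
  have h2 := integral_fourier_mul_char (summable_blaschkeCoeff one_pos hs2)
    (hasSum_blaschke one_pos hs2)
  simp only [ofReal_one, one_zpow, mul_one, one_mul] at h1 h2
  have c1 := continuous_blaschke_circle one_pos hs1
  have c2 := continuous_blaschke_circle one_pos hs2
  simp only [ofReal_one, one_mul] at c1 c2
  refine mul_right_cancel₀ hp ?_
  rw [sub_mul, sub_mul, mul_assoc, mul_assoc, ← h1, ← h1, ← h2, ← h2,
    ← intervalIntegral.integral_const_mul, ← intervalIntegral.integral_const_mul,
    ← integral_sub (Continuous.intervalIntegrable (by fun_prop) _ _)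
      (Continuous.intervalIntegrable (by fun_prop) _ _),
    ← integral_sub (Continuous.intervalIntegrable (by fun_prop) _ _)
      (Continuous.intervalIntegrable (by fun_prop) _ _)]
  congr 1 with t
  have hne := one_sub_conj_mul_ne_zero (w := w) (z := circleChar 1 t)
    (by simpa [norm_circleChar] using hw)
  have e1 : circleChar (-(j - 1)) t = circleChar 1 t * circleChar (-j) t := by
    rw [← circleChar_add]; ring_nf
  rw [blaschke_cons, blaschkeFactor, e1]
  generalize circleChar 1 t = z at hne
  rw [div_mul_eq_mul_div, div_mul_eq_mul_div, div_mul_eq_mul_div, mul_div_assoc',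
    ← sub_div, div_eq_iff hne]
  ring

theorem blaschkeCoeff_zero (j : ℤ) : blaschkeCoeff 0 j = if j = 0 then 1 else 0 := by
  have hp : (2 * Real.pi : ℂ) ≠ 0 := by simp [Real.pi_ne_zero]
  have h := integral_fourier_mul_char (summable_blaschkeCoeff (s := 0) one_pos (by simp))
    (hasSum_blaschke (s := 0) one_pos (by simp)) j
  simp only [blaschke_zero, one_mul, integral_circleChar, ofReal_one, one_zpow, mul_one,
    neg_eq_zero] at h
  refine mul_right_cancel₀ hp ?_
  rw [← h]
  split_ifs <;> simp

end

/-! ### Blaschke products of the shift acting on bounded sequences. -/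

section

open Complex

/-- The left shift on two-sided sequences. -/
def shift : Module.End ℂ (ℤ → ℂ) := LinearMap.funLeft ℂ ℂ (fun j => j + 1)

theorem shift_apply (a : ℤ → ℂ) (j : ℤ) : shift a j = a (j + 1) := rfl

theorem summable_norm_blaschkeCoeff {s : Multiset ℂ} (hs : ∀ w ∈ s, ‖w‖ < 1) :
    Summable fun j => ‖blaschkeCoeff s j‖ := by
  have := (summable_blaschkeCoeff (s := s) one_pos (by simpa using hs)).norm
  simpa using this

theorem summable_blaschkeCoeff_mul {s : Multiset ℂ} (hs : ∀ w ∈ s, ‖w‖ < 1) {a : ℤ → ℂ} {K : ℝ}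
    (ha : ∀ j, ‖a j‖ ≤ K) (l : ℤ) : Summable fun j => blaschkeCoeff s j * a (j + l) := by
  refine Summable.of_norm_bounded ((summable_norm_blaschkeCoeff hs).mul_right K) fun j => ?_
  rw [norm_mul]
  exact mul_le_mul_of_nonneg_left (ha _) (norm_nonneg _)

theorem norm_tsum_blaschkeCoeff_mul_le {s : Multiset ℂ} (hs : ∀ w ∈ s, ‖w‖ < 1) {a : ℤ → ℂ}
    {K : ℝ} (ha : ∀ j, ‖a j‖ ≤ K) (l : ℤ) :
    ‖∑' j, blaschkeCoeff s j * a (j + l)‖ ≤ (∑' j, ‖blaschkeCoeff s j‖) * K := by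
  refine tsum_of_norm_bounded ((summable_norm_blaschkeCoeff hs).hasSum.mul_right K) fun j => ?_
  rw [norm_mul]
  exact mul_le_mul_of_nonneg_left (ha _) (norm_nonneg _)

theorem tsum_blaschkeCoeff_cons {w : ℂ} {s : Multiset ℂ} (hw : ‖w‖ < 1) (hs : ∀ w ∈ s, ‖w‖ < 1)
    {a : ℤ → ℂ} {K : ℝ} (ha : ∀ j, ‖a j‖ ≤ K) (l : ℤ) :
    ∑' j, blaschkeCoeff (w ::ₘ s) j * a (j + l)
      - starRingEnd ℂ w * ∑' j, blaschkeCoeff (w ::ₘ s) j * a (j + (l + 1))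
      = ∑' j, blaschkeCoeff s j * (a (j + l + 1) - w * a (j + l)) := by
  have hs2 : ∀ w' ∈ w ::ₘ s, ‖w'‖ < 1 := by simpa using ⟨hw, hs⟩
  have h1 := (summable_blaschkeCoeff_mul hs2 ha l).hasSum
  have h2 := ((Equiv.subRight (1 : ℤ)).hasSum_iff.2
    (summable_blaschkeCoeff_mul hs2 ha (l + 1)).hasSum).mul_left (starRingEnd ℂ w)
  have h3 := (Equiv.subRight (1 : ℤ)).hasSum_iff.2
    (summable_blaschkeCoeff_mul hs ha (l + 1)).hasSum
  have h4 := (summable_blaschkeCoeff_mul hs ha l).hasSum.mul_left w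
  have h5 := (summable_blaschkeCoeff_mul hs ha (l + 1)).hasSum.sub h4
  refine ((h1.sub h2).unique ((congrArg (HasSum · _) (funext fun j => ?_)).mpr
    (h3.sub h4))).trans ?_
  · have := blaschkeCoeff_cons hw hs j
    simp only [Function.comp_apply, Equiv.subRight_apply]
    rw [show j - 1 + (l + 1) = j + l by ring]
    linear_combination a (j + l) * this
  · rw [← h5.tsum_eq]
    congr 1 with j
    rw [← add_assoc]
    ring

/-- A bounded sequence satisfying a linear recurrence with characteristic roots `s` in the open
unit disc is annihilated by the Blaschke product with zeros `s`. -/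
theorem tsum_blaschkeCoeff_mul_eq_zero {s : Multiset ℂ} (hs : ∀ w ∈ s, ‖w‖ < 1) {a : ℤ → ℂ} {K : ℝ}
    (ha : ∀ j, ‖a j‖ ≤ K)
    (h : ∀ l, 0 ≤ l → aeval shift (s.map fun w => X - C w).prod a l = 0) (l : ℤ) (hl : 0 ≤ l) :
    ∑' j, blaschkeCoeff s j * a (j + l) = 0 := by
  induction s using Multiset.induction_on generalizing a K l with
  | empty =>
    simp only [blaschkeCoeff_zero, ite_mul, one_mul, zero_mul, tsum_ite_eq, zero_add]
    simpa using h l hl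
  | cons w s ih =>
    have hs2 := hs
    simp only [Multiset.mem_cons, forall_eq_or_imp] at hs
    have hb : ∀ j, ‖(shift a - w • a) j‖ ≤ K + ‖w‖ * K := fun j => by
      rw [Pi.sub_apply, Pi.smul_apply, shift_apply, smul_eq_mul]
      refine (norm_sub_le _ _).trans (add_le_add (ha _) ?_)
      rw [norm_mul]
      exact mul_le_mul_of_nonneg_left (ha _) (norm_nonneg _)
    have h0 := ih hs.2 hb fun l hl => by
      have := h l hl
      rw [Multiset.map_cons, Multiset.prod_cons, mul_comm, map_mul, Module.End.mul_apply] at this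
      simpa [Module.algebraMap_end_apply] using this
    -- By the induction hypothesis for `shift a - w • a`, the correlation at `l` is `conj w` times
    -- the correlation at `l + 1`. Being bounded, it must vanish because `|w| < 1`.
    have hstep : ∀ l : ℤ, 0 ≤ l → ∑' j, blaschkeCoeff (w ::ₘ s) j * a (j + l)
        = starRingEnd ℂ w * ∑' j, blaschkeCoeff (w ::ₘ s) j * a (j + (l + 1)) := fun l hl => by
      rw [← sub_eq_zero, tsum_blaschkeCoeff_cons hs.1 hs.2 ha]
      simpa [shift_apply] using h0 l hl
    have hiter : ∀ k : ℕ, ∑' j, blaschkeCoeff (w ::ₘ s) j * a (j + l)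
        = starRingEnd ℂ w ^ k * ∑' j, blaschkeCoeff (w ::ₘ s) j * a (j + (l + k)) := fun k => by
      induction k with
      | zero => simp
      | succ k ihk =>
        rw [ihk, hstep _ (by omega), pow_succ, mul_assoc]
        push_cast
        simp only [add_assoc]
    have hbound : ∀ k : ℕ, ‖∑' j, blaschkeCoeff (w ::ₘ s) j * a (j + l)‖
        ≤ ‖w‖ ^ k * ((∑' j, ‖blaschkeCoeff (w ::ₘ s) j‖) * K) := fun k => by
      rw [hiter k, norm_mul, norm_pow, RCLike.norm_conj]
      exact mul_le_mul_of_nonneg_left (norm_tsum_blaschkeCoeff_mul_le hs2 ha _) (by positivity)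
    have hlim := (tendsto_pow_atTop_nhds_zero_of_lt_one (norm_nonneg w) hs.1).mul_const
      ((∑' j, ‖blaschkeCoeff (w ::ₘ s) j‖) * K)
    rw [zero_mul] at hlim
    exact norm_le_zero_iff.1 (ge_of_tendsto' hlim hbound)

/-- Justifies exchanging the two sums in the inversion formula: the shear `(i, l) ↦ (i, i + l)` is
injective, so a product of two summable families dominates. -/
theorem summable_blaschkeCoeff_shear {s : Multiset ℂ} (hs : ∀ w ∈ s, ‖w‖ < 1) {a : ℤ → ℂ} {K : ℝ}
    (ha : ∀ j, ‖a j‖ ≤ K) (n : ℤ) : Summable fun p : ℤ × ℤ =>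
      starRingEnd ℂ (blaschkeCoeff s p.1) * (blaschkeCoeff s (p.1 + p.2) * a (p.2 + n)) := by
  have hβ := summable_norm_blaschkeCoeff hs
  have h1 : Summable fun p : ℤ × ℤ => ‖blaschkeCoeff s p.1‖ * ‖blaschkeCoeff s p.2‖ :=
    hβ.mul_of_nonneg hβ (fun _ => norm_nonneg _) (fun _ => norm_nonneg _)
  have hinj : Function.Injective fun p : ℤ × ℤ => (p.1, p.1 + p.2) := by
    rintro ⟨i, l⟩ ⟨i', l'⟩ h
    simp only [Prod.mk.injEq] at h ⊢
    omega
  refine Summable.of_norm_bounded ((h1.comp_injective hinj).mul_right K) fun p => ?_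
  simp only [norm_mul, RCLike.norm_conj, Function.comp_apply]
  rw [← mul_assoc]
  exact mul_le_mul_of_nonneg_left (ha _) (by positivity)

theorem tsum_conj_blaschkeCoeff_mul {s : Multiset ℂ} (hs : ∀ w ∈ s, ‖w‖ < 1) (l : ℤ) (c : ℂ) :
    ∑' i, starRingEnd ℂ (blaschkeCoeff s i) * (blaschkeCoeff s (i + l) * c)
      = if l = 0 then c else 0 := by
  have h := ((Complex.hasSum_conj'.2 ((conj_conj (if l = 0 then (1 : ℂ) else 0)).symm ▸
    hasSum_autocorrelation_blaschkeCoeff hs l))).mul_right c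
  simp only [map_mul, conj_conj, mul_assoc] at h
  rw [h.tsum_eq]
  split_ifs <;> simp

/-- A bounded sequence is recovered from its correlation with the coefficients of a Blaschke
product. -/
theorem eq_tsum_conj_blaschkeCoeff {s : Multiset ℂ} (hs : ∀ w ∈ s, ‖w‖ < 1) {a : ℤ → ℂ} {K : ℝ}
    (ha : ∀ j, ‖a j‖ ≤ K) (n : ℤ) :
    a n = ∑' i, starRingEnd ℂ (blaschkeCoeff s i) *
      ∑' j, blaschkeCoeff s j * a (j + (n - i)) := by
  have h1 : ∀ i, ∑' j, blaschkeCoeff s j * a (j + (n - i))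
      = ∑' l, blaschkeCoeff s (i + l) * a (l + n) := fun i => by
    rw [← (Equiv.addLeft i).tsum_eq fun j => blaschkeCoeff s j * a (j + (n - i))]
    refine tsum_congr fun l => ?_
    rw [Equiv.coe_addLeft, show i + l + (n - i) = l + n by ring]
  have h2 : ∑' i, ∑' l, starRingEnd ℂ (blaschkeCoeff s i) * (blaschkeCoeff s (i + l) * a (l + n))
      = ∑' l, ∑' i, starRingEnd ℂ (blaschkeCoeff s i) * (blaschkeCoeff s (i + l) * a (l + n)) :=
    Summable.tsum_comm (f := fun l i => starRingEnd ℂ (blaschkeCoeff s i) *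
      (blaschkeCoeff s (i + l) * a (l + n)))
      ((summable_blaschkeCoeff_shear hs ha n).prod_symm)
  simp only [tsum_conj_blaschkeCoeff_mul hs, tsum_ite_eq, zero_add] at h2
  rw [← h2]
  refine tsum_congr fun i => ?_
  rw [h1, tsum_mul_left]

/-- In the inversion formula the inner sum sits at index `n - i`, so it vanishes for `i ≤ n`; only
the tail `i = n + 1 + k` remains. -/
theorem norm_le_tail_blaschkeCoeff {s : Multiset ℂ} (hs : ∀ w ∈ s, ‖w‖ < 1) {a : ℤ → ℂ} {K : ℝ}
    (ha : ∀ j, ‖a j‖ ≤ K)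
    (h : ∀ l, 0 ≤ l → aeval shift (s.map fun w => X - C w).prod a l = 0) (n : ℤ) :
    ‖a n‖ ≤ (∑' k : ℕ, ‖blaschkeCoeff s (n + 1 + k)‖) * ((∑' j, ‖blaschkeCoeff s j‖) * K) := by
  have hinj : Function.Injective fun k : ℕ => n + 1 + (k : ℤ) := fun i j hij => by
    simpa using hij
  rw [eq_tsum_conj_blaschkeCoeff hs ha n, ← hinj.tsum_eq]
  · refine tsum_of_norm_bounded
      (((summable_norm_blaschkeCoeff hs).comp_injective hinj).hasSum.mul_right _) fun k => ?_
    rw [norm_mul, RCLike.norm_conj]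
    exact mul_le_mul_of_nonneg_left (norm_tsum_blaschkeCoeff_mul_le hs ha _) (norm_nonneg _)
  · intro i hi
    by_contra hne
    have : i ≤ n := by
      by_contra! hlt
      exact hne ⟨(i - (n + 1)).toNat, by simp only; omega⟩
    exact hi (by
      simp only
      rw [tsum_blaschkeCoeff_mul_eq_zero hs ha h _ (by omega), mul_zero])

end

/-! ### Quantitative bounds for the coefficient sums and the scalar estimate. -/

section

/-- The Cauchy–Schwarz inequality for series. -/
theorem tsum_mul_le_of_sq {x y : ℕ → ℝ} {p q : ℝ} (hp : 0 < p) (hq : 0 < q)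
    (hx : Summable fun j => x j ^ 2) (hxp : ∑' j, x j ^ 2 ≤ p ^ 2)
    (hy : Summable fun j => y j ^ 2) (hyq : ∑' j, y j ^ 2 ≤ q ^ 2)
    (hxy : Summable fun j => x j * y j) : ∑' j, x j * y j ≤ p * q := by
  have h1 : ∀ j, x j * y j ≤ q / (2 * p) * x j ^ 2 + p / (2 * q) * y j ^ 2 := fun j => by
    have e : q / (2 * p) * x j ^ 2 + p / (2 * q) * y j ^ 2 - x j * y j
        = (q * x j - p * y j) ^ 2 / (2 * p * q) := by field_simp; ring
    have : 0 ≤ (q * x j - p * y j) ^ 2 / (2 * p * q) := by positivity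
    linarith
  have h2 := hxy.tsum_le_tsum h1 ((hx.mul_left _).add (hy.mul_left _))
  rw [(hx.mul_left _).tsum_add (hy.mul_left _), tsum_mul_left, tsum_mul_left] at h2
  have h3 : q / (2 * p) * ∑' j, x j ^ 2 ≤ q / (2 * p) * p ^ 2 := by gcongr
  have h4 : p / (2 * q) * ∑' j, y j ^ 2 ≤ p / (2 * q) * q ^ 2 := by gcongr
  have h5 : q / (2 * p) * p ^ 2 + p / (2 * q) * q ^ 2 = p * q := by field_simp; ring
  linarith

theorem tsum_int_norm_blaschkeCoeff (s : Multiset ℂ) :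
    ∑' j : ℤ, ‖blaschkeCoeff s j‖ = ∑' j : ℕ, ‖blaschkeCoeff s j‖ := by
  refine (Function.Injective.tsum_eq (g := (Nat.cast : ℕ → ℤ)) Nat.cast_injective
    fun j hj => ?_).symm
  by_contra hne
  refine hj ?_
  simp only
  rw [blaschkeCoeff_neg, norm_zero]
  by_contra! h0
  exact hne ⟨j.toNat, by omega⟩

/-- Cauchy–Schwarz applied to `|β j| R ^ j` and `R ^ (-j)`; Parseval bounds the first factor, a
geometric series the second. -/
theorem tsum_norm_blaschkeCoeff_le {s : Multiset ℂ} {R p q : ℝ} (hR1 : 1 < R)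
    (hR : ∀ w ∈ s, ‖w‖ * R < 1) (hp : 0 < p) (hq : 0 < q) (hpR : blaschkeMax s R ≤ p)
    (hqR : R ^ 2 / (R ^ 2 - 1) ≤ q ^ 2) : ∑' j : ℤ, ‖blaschkeCoeff s j‖ ≤ p * q := by
  have hR0 : 0 < R := by linarith
  obtain ⟨hs, hsum⟩ := summable_and_tsum_norm_sq_blaschkeCoeff_le hR1.le hR
  have hs' : ∀ w ∈ s, ‖w‖ < 1 := fun w hw => by nlinarith [hR w hw, norm_nonneg w]
  have hinj : Function.Injective (Nat.cast : ℕ → ℤ) := Nat.cast_injective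
  have e : ∀ j : ℕ, ‖blaschkeCoeff s j‖ * R ^ (j : ℤ) * R⁻¹ ^ j = ‖blaschkeCoeff s j‖ := fun j => by
    rw [zpow_natCast, mul_assoc, ← mul_pow, mul_inv_cancel₀ hR0.ne', one_pow, mul_one]
  have hgeo : HasSum (fun j : ℕ => (R⁻¹ ^ j) ^ 2) (R ^ 2 / (R ^ 2 - 1)) := by
    have h1 : (R⁻¹) ^ 2 < 1 := pow_lt_one₀ (by positivity) (inv_lt_one_of_one_lt₀ hR1) two_ne_zero
    have h2 := hasSum_geometric_of_lt_one (by positivity) h1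
    have h3 : R ^ 2 - 1 ≠ 0 := by nlinarith
    have h4 : (1 - R⁻¹ ^ 2)⁻¹ = R ^ 2 / (R ^ 2 - 1) := by
      rw [inv_pow, inv_eq_iff_eq_inv, inv_div]; field_simp
    rw [h4] at h2
    simpa only [← pow_mul, mul_comm] using h2
  have h := tsum_mul_le_of_sq (x := fun j : ℕ => ‖blaschkeCoeff s j‖ * R ^ (j : ℤ))
    (y := fun j : ℕ => R⁻¹ ^ j) hp hq (hs.comp_injective hinj)
    (((hs.comp_injective hinj).tsum_le_tsum_of_inj _ hinj (fun _ _ => by positivity)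
      (fun _ => le_rfl) hs).trans (hsum.trans
        (pow_le_pow_left₀ (blaschkeMax_nonneg hR1.le hR) hpR 2)))
    hgeo.summable (hgeo.tsum_eq.trans_le hqR)
    (by simpa only [e] using! (summable_norm_blaschkeCoeff hs').comp_injective hinj)
  simp only [e] at h
  rwa [tsum_int_norm_blaschkeCoeff]

theorem blaschkeMax_le_pow {s : Multiset ℂ} {R c : ℝ} (hR1 : 1 ≤ R) (hR : ∀ w ∈ s, ‖w‖ * R < 1)
    (hc : ∀ w ∈ s, (R - ‖w‖) / (1 - ‖w‖ * R) ≤ c) : blaschkeMax s R ≤ c ^ s.card := by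
  induction s using Multiset.induction_on with
  | empty => simp [blaschkeMax]
  | cons w s ih =>
    simp only [Multiset.mem_cons, forall_eq_or_imp] at hR hc
    rw [blaschkeMax, Multiset.map_cons, Multiset.prod_cons, Multiset.card_cons, pow_succ']
    have h0 := norm_nonneg w
    have h1 : 0 ≤ (R - ‖w‖) / (1 - ‖w‖ * R) := div_nonneg (by nlinarith) (by linarith)
    exact mul_le_mul hc.1 (ih hR.2 hc.2) (blaschkeMax_nonneg hR1 hR.2) (h1.trans hc.1)

/-- The Wiener norm of a Blaschke product of degree `d` with zeros in the disc of radius `r` is at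
most `2 e √(d / (1 - r))`. -/
theorem tsum_norm_blaschkeCoeff_le_sqrt {s : Multiset ℂ} {r : ℝ} (hr1 : r < 1)
    (hr : ∀ w ∈ s, ‖w‖ ≤ r) (hcard : 0 < s.card) :
    ∑' j : ℤ, ‖blaschkeCoeff s j‖ ≤ Real.exp 1 * (2 * Real.sqrt (s.card / (1 - r))) := by
  have hd : (1 : ℝ) ≤ s.card := by exact_mod_cast hcard
  obtain ⟨w₀, hw₀⟩ := Multiset.card_pos_iff_exists_mem.1 hcard
  have hr0 : 0 ≤ r := (norm_nonneg _).trans (hr _ hw₀)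
  set d : ℝ := (s.card : ℝ) with hd_def
  have hδ : 0 < 1 - r := by linarith
  -- With this `ε` each factor's maximum is at most `1 + 1/d`, so their product is at most `(1 +
  -- 1/d) ^ d ≤ e`. The `3` ensures `1 - r - ε ≥ 2 d ε`, as `d ≥ 1`.
  set ε : ℝ := (1 - r) / (3 * d) with hε_def
  have hε : 0 < ε := by positivity
  have hεd : 3 * d * ε = 1 - r := by rw [hε_def]; field_simp
  have hε3 : 3 * ε ≤ 1 - r := by nlinarith
  have hR : ∀ w ∈ s, 1 - ‖w‖ * (1 + ε) ≥ 1 - r - ε := fun w hw => by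
    have h1 := hr w hw
    have h2 := norm_nonneg w
    nlinarith
  have hfac : ∀ w ∈ s, (1 + ε - ‖w‖) / (1 - ‖w‖ * (1 + ε)) ≤ 1 + 1 / d := fun w hw => by
    have h1 := hr w hw
    have h2 := norm_nonneg w
    have h3 := hR w hw
    have h4 : 0 < 1 - ‖w‖ * (1 + ε) := by linarith
    rw [div_le_iff₀ h4]
    have h5 : 2 * ε * d ≤ 1 - ‖w‖ * (1 + ε) := by nlinarith
    have h6 : 2 * ε ≤ 1 / d * (1 - ‖w‖ * (1 + ε)) := by
      rw [one_div, inv_mul_eq_div, le_div_iff₀ (by linarith)]; exact h5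
    nlinarith
  refine tsum_norm_blaschkeCoeff_le (R := 1 + ε) (by linarith)
    (fun w hw => by linarith [hR w hw]) (Real.exp_pos 1) (by positivity) ?_ ?_
  · refine (blaschkeMax_le_pow (by linarith) (fun w hw => by linarith [hR w hw]) hfac).trans ?_
    have h1 : 1 + 1 / d ≤ Real.exp (1 / d) := by linarith [Real.add_one_le_exp (1 / d)]
    refine (pow_le_pow_left₀ (by positivity) h1 _).trans_eq ?_
    rw [← Real.exp_nat_mul, ← hd_def, mul_one_div_cancel (by linarith)]
  · rw [mul_pow, Real.sq_sqrt (by positivity), div_le_iff₀ (by nlinarith)]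
    have h1 : d / (1 - r) = 1 / (3 * ε) := by
      rw [← hεd]; field_simp
    rw [h1]
    have h2 : 2 ^ 2 * (1 / (3 * ε)) * ((1 + ε) ^ 2 - 1) = 4 / 3 * (2 + ε) := by
      field_simp; ring
    rw [h2]
    nlinarith

/-- The coefficient decay is used at radius `R = 1 / ρ`. Replacing the denominators `n + 1 + k` by
`n + 1` leaves a geometric series. -/
theorem tsum_tail_blaschkeCoeff_le {s : Multiset ℂ} {ρ : ℝ} (hρ0 : 0 < ρ) (hρ1 : ρ < 1)
    (hs : ∀ w ∈ s, ‖w‖ < ρ) (n : ℕ) :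
    ∑' k : ℕ, ‖blaschkeCoeff s (n + 1 + k)‖
      ≤ s.card * (s.map fun w : ℂ => (1 - ρ * ‖w‖) / (ρ - ‖w‖)).prod *
        (ρ ^ (n + 1) / ((n + 1) * (1 - ρ))) := by
  have hR1 : 1 ≤ ρ⁻¹ := (one_le_inv₀ hρ0).2 hρ1.le
  have hR : ∀ w ∈ s, ‖w‖ * ρ⁻¹ < 1 := fun w hw => by
    rw [← div_eq_mul_inv, div_lt_one hρ0]; exact hs w hw
  have hmax : blaschkeMax s ρ⁻¹ = (s.map fun w : ℂ => (1 - ρ * ‖w‖) / (ρ - ‖w‖)).prod := by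
    refine congrArg Multiset.prod (Multiset.map_congr rfl fun w hw => ?_)
    have h1 : ρ - ‖w‖ ≠ 0 := (sub_pos.2 (hs w hw)).ne'
    have h2 : 1 - ‖w‖ * ρ⁻¹ ≠ 0 := by linarith [hR w hw]
    rw [div_eq_div_iff h2 h1]
    field_simp
  rw [← hmax]
  set P := blaschkeMax s ρ⁻¹
  have hP : 0 ≤ P := blaschkeMax_nonneg hR1 hR
  have hgeo := ((hasSum_geometric_of_lt_one hρ0.le hρ1).mul_left
    (s.card * P * (ρ ^ (n + 1) / (n + 1))))
  have hterm : ∀ k : ℕ, ‖blaschkeCoeff s (n + 1 + k)‖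
      ≤ s.card * P * (ρ ^ (n + 1) / (n + 1)) * ρ ^ k := fun k => by
    have h := norm_blaschkeCoeff_mul_le hR1 hR (n + 1 + k)
    have hN : (0 : ℝ) < n + 1 + k := by positivity
    push_cast at h
    have h1 : ‖blaschkeCoeff s (n + 1 + k)‖ ≤ s.card * P * ρ ^ (n + 1 + k) / (n + 1 + k) := by
      rw [le_div_iff₀ hN]
      rw [inv_pow, ← div_eq_mul_inv, mul_div_assoc', div_le_iff₀ (by positivity)] at h
      linarith
    refine h1.trans ?_
    rw [mul_div_assoc, mul_assoc (_ * P)]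
    refine mul_le_mul_of_nonneg_left ?_ (by positivity)
    rw [pow_add ρ (n + 1) k, mul_div_right_comm]
    refine mul_le_mul_of_nonneg_right ?_ (by positivity)
    exact div_le_div_of_nonneg_left (by positivity) (by positivity)
      (by linarith [(Nat.cast_nonneg k : (0 : ℝ) ≤ k)])
  refine (Summable.tsum_le_tsum hterm (.of_nonneg_of_le (fun _ => norm_nonneg _) hterm
    hgeo.summable) hgeo.summable).trans_eq ?_
  rw [hgeo.tsum_eq]
  field_simp

/-- The bound for scalar sequences: a bounded solution of a linear recurrence with characteristic
roots `s` of modulus at most `μ`. -/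
theorem norm_le_of_recurrence {s : Multiset ℂ} {μ C : ℝ} {n : ℕ} (hμ0 : 0 < μ) (hμ1 : μ < 1)
    (hs : ∀ w ∈ s, ‖w‖ ≤ μ) {lamD : ℂ} (hlam : lamD ∈ s) (hlamμ : ‖lamD‖ = μ)
    (hn : μ / (1 - μ) < n) {a : ℤ → ℂ} (ha : ∀ j, ‖a j‖ ≤ 2 * C)
    (h : ∀ l, 0 ≤ l → aeval shift (s.map fun w => X - Polynomial.C w).prod a l = 0) :
    ‖a n‖ ≤ μ ^ n *
      (4 * C * Real.exp 1 ^ 2 * Real.sqrt (s.card : ℝ) * ((s.card : ℝ) + 1) /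
        (1 - (1 + 1 / (n : ℝ)) * μ) ^ (3 / 2 : ℝ)) *
      ((s.erase lamD).map fun z : ℂ =>
        (1 - (1 + 1 / (n : ℝ)) * μ * ‖z‖) / (μ - ‖z‖ + μ / (n : ℝ))).prod := by
  have hn0 : (0 : ℝ) < n := lt_trans (div_pos hμ0 (by linarith)) hn
  have hC : 0 ≤ C := by linarith [(norm_nonneg _).trans (ha 0)]
  -- Being slightly larger than `μ`, `ρ` keeps the poles outside the circle of radius `1 / ρ`, while
  -- `ρ ^ n ≤ e μ ^ n`. The hypothesis on `n` says exactly `ρ < 1`.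
  set ρ := (1 + 1 / (n : ℝ)) * μ with hρ
  have hρμ : ρ = μ + μ / n := by rw [hρ]; ring
  have hρ0 : 0 < ρ := by positivity
  have hμn : 0 < μ / n := by positivity
  have hρ1 : ρ < 1 := by
    rw [div_lt_iff₀ (by linarith)] at hn
    rw [hρμ, ← sub_pos]
    have : 1 - (μ + μ / n) = (n * (1 - μ) - μ) / n := by field_simp; ring
    rw [this]
    exact div_pos (by linarith) hn0
  have hδ : 0 < 1 - ρ := by linarith
  have hs1 : ∀ w ∈ s, ‖w‖ < 1 := fun w hw => (hs w hw).trans_lt hμ1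
  have hsρ : ∀ w ∈ s, ‖w‖ < ρ := fun w hw => by linarith [hs w hw]
  have hcard : 0 < s.card := Multiset.card_pos_iff_exists_mem.2 ⟨_, hlam⟩
  have hd : (1 : ℝ) ≤ s.card := by exact_mod_cast hcard
  have hmain := norm_le_tail_blaschkeCoeff hs1 ha h n
  have hS := tsum_norm_blaschkeCoeff_le_sqrt hρ1 (fun w hw => (hsρ w hw).le) hcard
  have htail := tsum_tail_blaschkeCoeff_le hρ0 hρ1 hsρ n
  have hQ : ((s.erase lamD).map fun z : ℂ => (1 - ρ * ‖z‖) / (μ - ‖z‖ + μ / (n : ℝ)))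
      = (s.erase lamD).map fun w : ℂ => (1 - ρ * ‖w‖) / (ρ - ‖w‖) :=
    Multiset.map_congr rfl fun w _ => by rw [hρμ, show μ + μ / n - ‖w‖ = μ - ‖w‖ + μ / n by ring]
  rw [hQ]
  have hP : (s.map fun w : ℂ => (1 - ρ * ‖w‖) / (ρ - ‖w‖)).prod
      = (1 - ρ * μ) / (ρ - μ) *
        ((s.erase lamD).map fun w : ℂ => (1 - ρ * ‖w‖) / (ρ - ‖w‖)).prod := by
    conv_lhs => rw [← Multiset.cons_erase hlam]
    rw [Multiset.map_cons, Multiset.prod_cons, hlamμ]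
  set Q := ((s.erase lamD).map fun w : ℂ => (1 - ρ * ‖w‖) / (ρ - ‖w‖)).prod
  have hQ0 : 0 ≤ Q := Multiset.prod_nonneg fun x hx => by
    obtain ⟨w, hw, rfl⟩ := Multiset.mem_map.1 hx
    have h1 := hsρ w (Multiset.mem_of_mem_erase hw)
    have h2 := norm_nonneg w
    exact div_nonneg (by nlinarith) (by linarith)
  set d : ℝ := (s.card : ℝ)
  -- The factor of the dominant root `lamD` costs `n / μ`, which is absorbed by `(1 + 1/n) μ / (n +
  -- 1) = μ / n` from the tail.
  have hfirst : (1 - ρ * μ) / (ρ - μ) ≤ n / μ := by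
    rw [show ρ - μ = μ / n by rw [hρμ]; ring, div_le_div_iff₀ hμn hμ0,
      mul_div_cancel₀ _ hn0.ne']
    nlinarith [mul_pos hρ0 hμ0]
  have hpow : ρ ^ (n + 1) ≤ Real.exp 1 * (1 + 1 / n) * μ ^ (n + 1) := by
    rw [hρ, mul_pow, pow_succ (1 + 1 / (n : ℝ))]
    gcongr
    have h1 : 1 + 1 / (n : ℝ) ≤ Real.exp (1 / n) := by linarith [Real.add_one_le_exp (1 / (n : ℝ))]
    refine (pow_le_pow_left₀ (by positivity) h1 _).trans_eq ?_
    rw [← Real.exp_nat_mul, mul_one_div_cancel hn0.ne']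
  have htail2 : ∑' k : ℕ, ‖blaschkeCoeff s (n + 1 + k)‖
      ≤ d * Q * (Real.exp 1 * μ ^ n) / (1 - ρ) := by
    refine htail.trans ?_
    rw [hP]
    have h1 : ρ ^ (n + 1) / ((n + 1) * (1 - ρ))
        ≤ Real.exp 1 * (1 + 1 / n) * μ ^ (n + 1) / ((n + 1) * (1 - ρ)) := by gcongr
    have h2 : d * ((1 - ρ * μ) / (ρ - μ) * Q) ≤ d * (n / μ * Q) := by gcongr
    refine (mul_le_mul h2 h1 (by positivity) (by positivity)).trans_eq ?_
    field_simp
    ring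
  have hpow32 : (1 - ρ) ^ (3 / 2 : ℝ) = (1 - ρ) * Real.sqrt (1 - ρ) := by
    rw [show (3 / 2 : ℝ) = 1 + 1 / 2 by norm_num, Real.rpow_add hδ, Real.rpow_one,
      ← Real.sqrt_eq_rpow]
  have hsq : 0 < Real.sqrt (1 - ρ) := Real.sqrt_pos.2 hδ
  have hsd : 0 ≤ Real.sqrt d := Real.sqrt_nonneg _
  rw [Real.sqrt_div (by linarith)] at hS
  have h2 := mul_le_mul htail2 (mul_le_mul_of_nonneg_right hS (by linarith : 0 ≤ 2 * C))
    (mul_nonneg (tsum_nonneg fun _ => norm_nonneg _) (by linarith)) (by positivity)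
  refine hmain.trans (h2.trans ?_)
  rw [hpow32]
  have e1 : d * Q * (Real.exp 1 * μ ^ n) / (1 - ρ) *
      (Real.exp 1 * (2 * (Real.sqrt d / Real.sqrt (1 - ρ))) * (2 * C))
      = μ ^ n * (4 * C * Real.exp 1 ^ 2 * Real.sqrt d * d / ((1 - ρ) * Real.sqrt (1 - ρ))) * Q := by
    field_simp
    ring
  rw [e1]
  -- The argument gives the factor `d`; the stated bound has the larger `d + 1`.
  gcongr
  linarith

end

/-! ### From operators to scalar sequences by duality. -/

section

open Filter Topology

/-- The Hahn–Banach theorem for seminorms. -/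
theorem exists_dual_seminorm {𝕜 W : Type*} [RCLike 𝕜] [AddCommGroup W] [Module 𝕜 W]
    (N : Seminorm 𝕜 W) (x : W) :
    ∃ g : W →ₗ[𝕜] 𝕜, (∀ y, ‖g y‖ ≤ N y) ∧ ‖g x‖ = N x := by
  let : Norm W := ⟨N⟩
  have core : SeminormedSpace.Core 𝕜 W :=
    ⟨apply_nonneg N, map_smul_eq_mul N, map_add_le_add N⟩
  let := SeminormedAddCommGroup.ofCore core
  let : NormedSpace 𝕜 W := ⟨fun c y => (map_smul_eq_mul N c y).le⟩
  obtain ⟨g, hg, hgx⟩ := exists_dual_vector'' 𝕜 x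
  refine ⟨g, fun y => ?_, ?_⟩
  · exact (g.le_opNorm y).trans ((mul_le_mul_of_nonneg_right hg (norm_nonneg y)).trans_eq
      (one_mul _))
  · have h : ‖g x‖ = ‖x‖ := by rw [hgx]; simp
    exact h

theorem exists_norm_le_mul_seminorm {𝕜 W F : Type*} [RCLike 𝕜] [AddCommGroup W] [Module 𝕜 W]
    [FiniteDimensional 𝕜 W] [NormedAddCommGroup F] [NormedSpace 𝕜 F]
    (N : Seminorm 𝕜 W) (hN : ∀ x, N x = 0 → x = 0) (f : W →ₗ[𝕜] F) :
    ∃ M, 0 ≤ M ∧ ∀ x, ‖f x‖ ≤ M * N x := by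
  let : Norm W := ⟨N⟩
  have core : NormedSpace.Core 𝕜 W :=
    { norm_nonneg := apply_nonneg N
      norm_smul := map_smul_eq_mul N
      norm_triangle := map_add_le_add N
      norm_eq_zero_iff := fun x => ⟨hN x, fun h => by rw [h]; exact map_zero N⟩ }
  let := NormedAddCommGroup.ofCore core
  let : NormedSpace 𝕜 W := ⟨fun c y => (map_smul_eq_mul N c y).le⟩
  exact ⟨‖f.toContinuousLinearMap‖, norm_nonneg _, f.toContinuousLinearMap.le_opNorm⟩

/-- In a finite-dimensional complex space, weak convergence to zero implies convergence to zero in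
every real seminorm. -/
theorem tendsto_seminorm_zero {W α : Type*} [AddCommGroup W] [Module ℂ W] [Module ℝ W]
    [IsScalarTower ℝ ℂ W] [FiniteDimensional ℂ W] (p : Seminorm ℝ W) {l : Filter α} {x : α → W}
    (h : ∀ φ : W →ₗ[ℂ] ℂ, Tendsto (fun a => φ (x a)) l (𝓝 0)) :
    Tendsto (fun a => p (x a)) l (𝓝 0) := by
  set b := Module.finBasis ℂ W
  -- A real seminorm is not homogeneous for complex scalars, so `w` and `I • w` are both needed.
  have hsmul : ∀ (c : ℂ) (w : W), p (c • w) ≤ ‖c‖ * (p w + p (Complex.I • w)) := fun c w => by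
    have e : c • w = c.re • w + c.im • (Complex.I • w) := by
      rw [← smul_assoc, ← algebraMap_smul ℂ c.re w, ← add_smul]
      congr 1
      simp
    rw [e, mul_add]
    refine (map_add_le_add p _ _).trans ?_
    rw [map_smul_eq_mul, map_smul_eq_mul, Real.norm_eq_abs, Real.norm_eq_abs]
    have := apply_nonneg p w
    have := apply_nonneg p (Complex.I • w)
    have := Complex.abs_re_le_norm c
    have := Complex.abs_im_le_norm c
    gcongr
  have hle : ∀ a, p (x a) ≤ ∑ i, ‖b.coord i (x a)‖ * (p (b i) + p (Complex.I • b i)) := fun a => by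
    conv_lhs => rw [← b.sum_repr (x a)]
    refine (Finset.le_sum_of_subadditive p (map_zero p).le (map_add_le_add p) _ _).trans (Finset.sum_le_sum fun i _ => hsmul _ _)
  refine squeeze_zero (fun a => apply_nonneg p _) hle ?_
  rw [show (0 : ℝ) = ∑ i, ‖(0 : ℂ)‖ * (p (b i) + p (Complex.I • b i)) by simp]
  exact tendsto_finsetSum _ fun i _ => (h (b.coord i)).norm.mul_const _

theorem shift_pow_apply (k : ℕ) (a : ℤ → ℂ) (l : ℤ) : (shift ^ k) a l = a (l + k) := by
  induction k generalizing l with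
  | zero => simp
  | succ k ih =>
    rw [pow_succ', Module.End.mul_apply, shift_apply, ih]
    push_cast
    ring_nf

/-- The orbit of an operator under a functional satisfies the recurrences given by polynomials in
the operator. -/
theorem aeval_shift_orbit {𝕜 W : Type*} [Field 𝕜] [Algebra 𝕜 ℂ] [AddCommGroup W] [Module 𝕜 W]
    (A : Module.End 𝕜 W) (φ : Module.End 𝕜 W →ₗ[𝕜] 𝕜) (p : 𝕜[X]) (l : ℕ) :
    aeval shift (p.map (algebraMap 𝕜 ℂ)) (fun j => algebraMap 𝕜 ℂ (φ (A ^ j.toNat))) l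
      = algebraMap 𝕜 ℂ (φ (A ^ l * aeval A p)) := by
  induction p using Polynomial.induction_on' with
  | add p q hp hq => simp only [Polynomial.map_add, map_add, LinearMap.add_apply, Pi.add_apply, hp,
      hq, mul_add]
  | monomial k c =>
    rw [Polynomial.map_monomial, aeval_monomial, aeval_monomial, Module.End.mul_apply,
      Module.algebraMap_end_apply, Pi.smul_apply, shift_pow_apply, ← Nat.cast_add, Int.toNat_natCast,
      ← Algebra.smul_def c (A ^ k), mul_smul_comm, map_smul, ← pow_add, smul_eq_mul, smul_eq_mul,
      map_mul]

theorem aeval_shift_orbit_minpoly {𝕜 W : Type*} [Field 𝕜] [Algebra 𝕜 ℂ] [AddCommGroup W]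
    [Module 𝕜 W] [FiniteDimensional 𝕜 W] (A : Module.End 𝕜 W) (φ : Module.End 𝕜 W →ₗ[𝕜] 𝕜)
    (l : ℤ) (hl : 0 ≤ l) :
    aeval shift ((((minpoly 𝕜 A).map (algebraMap 𝕜 ℂ)).roots).map fun w => X - C w).prod
      (fun j => algebraMap 𝕜 ℂ (φ (A ^ j.toNat))) l = 0 := by
  have hm : (minpoly 𝕜 A).Monic := minpoly.monic (Algebra.IsIntegral.isIntegral A)
  rw [← (IsAlgClosed.splits _).eq_prod_roots_of_monic (hm.map (algebraMap 𝕜 ℂ))]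
  lift l to ℕ using hl
  rw [aeval_shift_orbit, minpoly.aeval, mul_zero, map_zero, map_zero]

/-- The bound for an operator whose powers are bounded by `2 * C`. -/
theorem seminorm_pow_le_factorwiseBound {𝕜 W : Type*} [RCLike 𝕜] [NormedAlgebra 𝕜 ℂ]
    [AddCommGroup W] [Module 𝕜 W] [FiniteDimensional 𝕜 W] (N : Seminorm 𝕜 (Module.End 𝕜 W))
    (A : Module.End 𝕜 W) {C μ : ℝ} (hC : ∀ k : ℕ, N (A ^ k) ≤ 2 * C) {m : ℂ[X]}
    (hm : m = (minpoly 𝕜 A).map (algebraMap 𝕜 ℂ)) (hμ0 : 0 < μ) (hμ1 : μ < 1)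
    (hroots : ∀ z ∈ m.roots, ‖z‖ ≤ μ) {lamD : ℂ} (hlam : lamD ∈ m.roots) (hlamμ : ‖lamD‖ = μ)
    {n : ℕ} (hn : μ / (1 - μ) < n) : N (A ^ n) ≤ factorwiseBound C μ m lamD n := by
  obtain ⟨φ, hφ, hφn⟩ := exists_dual_seminorm N (A ^ n)
  have hrec := aeval_shift_orbit_minpoly A φ
  rw [← hm] at hrec
  -- Negative indices carry the constant `φ 1`: the sequence must be bounded everywhere, but the
  -- recurrence is only required at `l ≥ 0`.
  have hbound : ∀ j : ℤ, ‖algebraMap 𝕜 ℂ (φ (A ^ j.toNat))‖ ≤ 2 * C := fun j => by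
    rw [norm_algebraMap']
    exact (hφ _).trans (hC _)
  have h := norm_le_of_recurrence hμ0 hμ1 hroots hlam hlamμ hn hbound hrec
  rw [Int.toNat_natCast, norm_algebraMap', hφn] at h
  have hcard : m.roots.card = m.natDegree := (IsAlgClosed.splits m).natDegree_eq_card_roots.symm
  have herase : (m /ₘ (X - Polynomial.C lamD)).roots = m.roots.erase lamD := by
    have h1 := mul_divByMonic_eq_iff_isRoot.2 (isRoot_of_mem_roots hlam)
    have h2 : (X - Polynomial.C lamD) * (m /ₘ (X - Polynomial.C lamD)) ≠ 0 := by
      rw [h1]; exact ne_zero_of_mem_roots hlam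
    conv_rhs => rw [← h1, roots_mul h2, roots_X_sub_C]
    simp
  rw [factorwiseBound, herase, ← hcard]
  exact h

/-- The same tail inequality without a rate: tails of a summable series tend to zero. -/
theorem tendsto_orbit_zero {W : Type*} [AddCommGroup W] [Module ℂ W] [FiniteDimensional ℂ W]
    (A : Module.End ℂ W) (hA : ∀ z, A.HasEigenvalue z → ‖z‖ < 1) (φ : Module.End ℂ W →ₗ[ℂ] ℂ)
    {K : ℝ} (hφ : ∀ k : ℕ, ‖φ (A ^ k)‖ ≤ K) :
    Tendsto (fun k : ℕ => φ (A ^ k)) atTop (𝓝 0) := by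
  have hrec := aeval_shift_orbit_minpoly A φ
  have hs : ∀ w ∈ ((minpoly ℂ A).map (algebraMap ℂ ℂ)).roots, ‖w‖ < 1 := fun w hw => by
    rw [Algebra.algebraMap_self, Polynomial.map_id] at hw
    exact hA w (Module.End.hasEigenvalue_iff_isRoot.2 (isRoot_of_mem_roots hw))
  have h := fun n : ℕ => norm_le_tail_blaschkeCoeff hs (K := K) (fun j => by simpa using hφ _) hrec n
  simp only [Algebra.algebraMap_self_apply, Int.toNat_natCast] at h
  refine squeeze_zero_norm h ?_
  have hinj : Function.Injective (Nat.cast : ℕ → ℤ) := Nat.cast_injective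
  have h1 := (tendsto_sum_nat_add (fun k : ℕ =>
    ‖blaschkeCoeff ((minpoly ℂ A).map (algebraMap ℂ ℂ)).roots k‖)).comp (tendsto_add_atTop_nat 1)
  have h2 := h1.mul_const
    ((∑' j, ‖blaschkeCoeff ((minpoly ℂ A).map (algebraMap ℂ ℂ)).roots j‖) * K)
  rw [zero_mul] at h2
  refine h2.congr fun n => ?_
  refine congrArg (· * _) (tsum_congr fun k => ?_)
  rw [show ((k + (n + 1) : ℕ) : ℤ) = n + 1 + k by push_cast; ring]

end

/-! ### Spectral splitting of a power bounded operator. -/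

section

open Filter Topology

section Operator

variable {E : Type*} [AddCommGroup E] [Module ℂ E]

theorem maxGenEigenspace_eq_zero {S : Module.End ℂ E} {z : ℂ} (hz : ¬ S.HasEigenvalue z) {x : E}
    (hx : x ∈ S.maxGenEigenspace z) : x = 0 := by
  obtain ⟨k, hk⟩ := (Module.End.mem_maxGenEigenspace S z x).1 hx
  by_contra hne
  have h1 : S.HasUnifEigenvalue z k := by
    rw [Module.End.HasUnifEigenvalue]
    intro h0
    have : x ∈ S.genEigenspace z k := (Module.End.mem_genEigenspace_nat).2 hk
    rw [h0] at this
    exact hne ((Submodule.mem_bot ℂ).1 this)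
  exact hz (Module.End.hasEigenvalue_of_hasGenEigenvalue h1)

/-- An operator all of whose orbits are bounded. -/
def WeaklyPowerBounded (S : Module.End ℂ E) : Prop :=
  ∀ φ : Module.End ℂ E →ₗ[ℂ] ℂ, ∃ M, ∀ k : ℕ, ‖φ (S ^ k)‖ ≤ M

theorem WeaklyPowerBounded.apply {S : Module.End ℂ E} (hS : WeaklyPowerBounded S) (x : E)
    (f : Module.Dual ℂ E) : ∃ M, ∀ k : ℕ, ‖f ((S ^ k) x)‖ ≤ M :=
  hS (f ∘ₗ LinearMap.applyₗ x)

variable [FiniteDimensional ℂ E]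

theorem spectralProjector_apply_self {S : Module.End ℂ E} {z : ℂ} {x : E}
    (hx : x ∈ S.maxGenEigenspace z) : spectralProjector S z x = x :=
  Submodule.projection_apply_of_mem_left (isCompl_maxGenEigenspace S z) hx

theorem spectralProjector_apply_of_ne {S : Module.End ℂ E} {z w : ℂ} (h : w ≠ z) {x : E}
    (hx : x ∈ S.maxGenEigenspace w) : spectralProjector S z x = 0 :=
  (Submodule.projection_apply_eq_zero_iff (isCompl_maxGenEigenspace S z)).2
    (Submodule.mem_iSup_of_mem w (Submodule.mem_iSup_of_mem h hx))

theorem end_ext_maxGenEigenspace (S : Module.End ℂ E) {X Y : Module.End ℂ E}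
    (h : ∀ z, ∀ x ∈ S.maxGenEigenspace z, X x = Y x) : X = Y := by
  have : ⨆ z, S.maxGenEigenspace z ≤ LinearMap.eqLocus X Y := iSup_le h
  rw [Module.End.iSup_maxGenEigenspace_eq_top] at this
  exact LinearMap.ext fun x => this trivial

/-- The combination of the spectral projectors at the eigenvalues of magnitude one with weights
`f`. -/
def peripheralSum (S : Module.End ℂ E) (f : ℂ → ℂ) : Module.End ℂ E :=
  ∑ z ∈ (finite_peripheral S).toFinset, f z • spectralProjector S z

theorem peripheralSum_apply_of_norm_eq_one {S : Module.End ℂ E} (f : ℂ → ℂ) {w : ℂ} (hw : ‖w‖ = 1)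
    {x : E} (hx : x ∈ S.maxGenEigenspace w) : peripheralSum S f x = f w • x := by
  by_cases he : S.HasEigenvalue w
  · rw [peripheralSum, LinearMap.sum_apply, Finset.sum_eq_single w]
    · rw [LinearMap.smul_apply, spectralProjector_apply_self hx]
    · intro z _ hz
      rw [LinearMap.smul_apply, spectralProjector_apply_of_ne hz.symm hx, smul_zero]
    · intro h
      exact absurd ((finite_peripheral S).mem_toFinset.2 ⟨he, hw⟩) h
  · rw [maxGenEigenspace_eq_zero he hx]; simp

theorem peripheralSum_apply_of_norm_ne_one {S : Module.End ℂ E} (f : ℂ → ℂ) {w : ℂ} (hw : ‖w‖ ≠ 1)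
    {x : E} (hx : x ∈ S.maxGenEigenspace w) : peripheralSum S f x = 0 := by
  rw [peripheralSum, LinearMap.sum_apply]
  refine Finset.sum_eq_zero fun z hz => ?_
  have : w ≠ z := by
    rintro rfl
    exact hw ((finite_peripheral S).mem_toFinset.1 hz).2
  rw [LinearMap.smul_apply, spectralProjector_apply_of_ne this hx, smul_zero]

theorem asymptoticPart_apply_of_norm_eq_one {S : Module.End ℂ E} {w : ℂ} (hw : ‖w‖ = 1)
    {x : E} (hx : x ∈ S.maxGenEigenspace w) : asymptoticPart S x = w • x :=
  peripheralSum_apply_of_norm_eq_one (fun z => z) hw hx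

theorem asymptoticPart_apply_of_norm_ne_one {S : Module.End ℂ E} {w : ℂ} (hw : ‖w‖ ≠ 1)
    {x : E} (hx : x ∈ S.maxGenEigenspace w) : asymptoticPart S x = 0 :=
  peripheralSum_apply_of_norm_ne_one (fun z => z) hw hx

theorem asymptoticPart_pow (S : Module.End ℂ E) {k : ℕ} (hk : k ≠ 0) :
    asymptoticPart S ^ k = peripheralSum S (fun z => z ^ k) := by
  refine end_ext_maxGenEigenspace S fun w x hx => ?_
  by_cases hw : ‖w‖ = 1
  · rw [peripheralSum_apply_of_norm_eq_one _ hw hx]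
    clear hk
    induction k with
    | zero => simp
    | succ k ih =>
      rw [pow_succ, Module.End.mul_apply, asymptoticPart_apply_of_norm_eq_one hw hx, map_smul, ih,
        smul_smul, pow_succ']
  · obtain ⟨k, rfl⟩ := Nat.exists_eq_succ_of_ne_zero hk
    rw [peripheralSum_apply_of_norm_ne_one _ hw hx, Nat.succ_eq_add_one, pow_succ,
      Module.End.mul_apply, asymptoticPart_apply_of_norm_ne_one hw hx, map_zero]

theorem exists_dual_ne_zero {x : E} (hx : x ≠ 0) : ∃ f : Module.Dual ℂ E, f x ≠ 0 := by
  by_contra! h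
  exact hx ((Module.forall_dual_apply_eq_zero_iff ℂ x).1 h)

theorem WeaklyPowerBounded.norm_eigenvalue_le {S : Module.End ℂ E} (hS : WeaklyPowerBounded S)
    {z : ℂ} (hz : S.HasEigenvalue z) : ‖z‖ ≤ 1 := by
  obtain ⟨x, hx⟩ := hz.exists_hasEigenvector
  obtain ⟨f, hf⟩ := exists_dual_ne_zero hx.2
  obtain ⟨M, hM⟩ := hS.apply x f
  by_contra! h
  have h1 := (tendsto_pow_atTop_atTop_of_one_lt h).atTop_mul_const (norm_pos_iff.2 hf)
  obtain ⟨k, hk⟩ := (h1.eventually_gt_atTop M).exists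
  have h2 := hM k
  rw [hx.pow_apply, map_smul, norm_smul, norm_pow] at h2
  linarith

/-- A Jordan chain of length two at a unimodular eigenvalue would make the orbit of `x` grow
linearly. -/
theorem WeaklyPowerBounded.sub_apply_eq_zero {S : Module.End ℂ E} (hS : WeaklyPowerBounded S)
    {z : ℂ} (hz : ‖z‖ = 1) {x : E}
    (hx : S (S x - z • x) = z • (S x - z • x)) : S x - z • x = 0 := by
  set y := S x - z • x with hy
  have hSx : S x = z • x + y := by rw [hy]; abel
  -- The extra factor `z` on the left avoids the exponent `k - 1`.
  have hpow : ∀ k : ℕ, z • (S ^ k) x = z ^ (k + 1) • x + ((k : ℂ) * z ^ k) • y := fun k => by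
    induction k with
    | zero => simp
    | succ k ih =>
      rw [pow_succ', Module.End.mul_apply, ← map_smul, ih, map_add, map_smul, map_smul, hSx, hx]
      push_cast
      module
  by_contra hne
  obtain ⟨f, hf⟩ := exists_dual_ne_zero hne
  obtain ⟨M, hM⟩ := hS.apply x f
  have h1 := tendsto_natCast_atTop_atTop.atTop_mul_const (norm_pos_iff.2 hf)
  obtain ⟨k, hk⟩ := (h1.eventually_gt_atTop (M + ‖f x‖)).exists
  have h2 := congrArg f (hpow k)
  rw [map_smul, map_add, map_smul, map_smul, smul_eq_mul, smul_eq_mul, smul_eq_mul] at h2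
  have h3 : (k : ℂ) * z ^ k * f y = z * f ((S ^ k) x) - z ^ (k + 1) * f x := by rw [h2]; ring
  have h4 := norm_sub_le (z * f ((S ^ k) x)) (z ^ (k + 1) * f x)
  rw [← h3] at h4
  simp only [norm_mul, norm_pow, hz, one_pow, one_mul, mul_one, Complex.norm_natCast] at h4
  have := hM k
  linarith

/-- Power bounded operators act diagonally on the generalized eigenspaces of magnitude one. -/
theorem WeaklyPowerBounded.apply_of_mem {S : Module.End ℂ E} (hS : WeaklyPowerBounded S)
    {z : ℂ} (hz : ‖z‖ = 1) {x : E} (hx : x ∈ S.maxGenEigenspace z) : S x = z • x := by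
  obtain ⟨k, hk⟩ := (Module.End.mem_maxGenEigenspace S z x).1 hx
  clear hx
  induction k generalizing x with
  | zero => simp_all
  | succ k ih =>
    rw [pow_succ, Module.End.mul_apply] at hk
    have h1 := ih hk
    rw [LinearMap.sub_apply, LinearMap.smul_apply, Module.End.one_apply] at h1
    exact sub_eq_zero.1 (hS.sub_apply_eq_zero hz h1)

/-- On generalized eigenspaces with `|w| = 1`, `S` and its asymptotic part agree; on the others the
asymptotic part vanishes. -/
theorem WeaklyPowerBounded.sub_mul_asymptoticPart {S : Module.End ℂ E} (hS : WeaklyPowerBounded S) :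
    (S - asymptoticPart S) * asymptoticPart S = 0 := by
  refine end_ext_maxGenEigenspace S fun w x hx => ?_
  rw [Module.End.mul_apply]
  by_cases hw : ‖w‖ = 1
  · rw [asymptoticPart_apply_of_norm_eq_one hw hx, map_smul, LinearMap.sub_apply,
      asymptoticPart_apply_of_norm_eq_one hw hx, hS.apply_of_mem hw hx]
    simp
  · rw [asymptoticPart_apply_of_norm_ne_one hw hx]
    simp

theorem WeaklyPowerBounded.asymptoticPart_mul_sub {S : Module.End ℂ E} (hS : WeaklyPowerBounded S) :
    asymptoticPart S * (S - asymptoticPart S) = 0 := by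
  refine end_ext_maxGenEigenspace S fun w x hx => ?_
  rw [Module.End.mul_apply, LinearMap.sub_apply]
  by_cases hw : ‖w‖ = 1
  · rw [asymptoticPart_apply_of_norm_eq_one hw hx, hS.apply_of_mem hw hx]
    simp
  · rw [asymptoticPart_apply_of_norm_ne_one hw hx, sub_zero]
    exact asymptoticPart_apply_of_norm_ne_one hw
      (Module.End.mapsTo_maxGenEigenspace_of_comm (Commute.refl S) w hx)

/-- If `A = T - T'` and `A T' = T' A = 0`, then positive powers split. -/
theorem pow_eq_add_pow {R : Type*} [Ring R] {T T' : R} (h1 : (T - T') * T' = 0)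
    (h2 : T' * (T - T') = 0) {k : ℕ} (hk : k ≠ 0) : T ^ k = (T - T') ^ k + T' ^ k := by
  obtain ⟨k, rfl⟩ := Nat.exists_eq_succ_of_ne_zero hk
  clear hk
  induction k with
  | zero => simp
  | succ k ih =>
    have e1 : (T - T') ^ k.succ * T' = 0 := by
      rw [Nat.succ_eq_add_one, pow_succ, mul_assoc, h1, mul_zero]
    have e2 : T' ^ k.succ * (T - T') = 0 := by
      rw [Nat.succ_eq_add_one, pow_succ, mul_assoc, h2, mul_zero]
    calc T ^ (k.succ + 1) = ((T - T') ^ k.succ + T' ^ k.succ) * ((T - T') + T') := by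
          rw [pow_succ, ih]; simp
      _ = (T - T') ^ (k.succ + 1) + T' ^ (k.succ + 1) := by
          rw [add_mul, mul_add, mul_add, e1, e2, pow_succ _ k.succ, pow_succ _ k.succ]; simp

/-- An eigenvector with `z ≠ 0` is killed by the asymptotic part, hence is an eigenvector of `S`;
`|z| = 1` would contradict this vanishing. -/
theorem WeaklyPowerBounded.norm_eigenvalue_sub_lt {S : Module.End ℂ E} (hS : WeaklyPowerBounded S)
    {z : ℂ} (hz : (S - asymptoticPart S).HasEigenvalue z) : ‖z‖ < 1 := by
  obtain ⟨x, hx⟩ := hz.exists_hasEigenvector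
  rcases eq_or_ne z 0 with rfl | hz0
  · simp
  have h1 := congrArg (· x) hS.asymptoticPart_mul_sub
  simp only [Module.End.mul_apply, hx.apply_eq_smul, map_smul, LinearMap.zero_apply,
    smul_eq_zero, hz0, false_or] at h1
  have h2 := hx.apply_eq_smul
  rw [LinearMap.sub_apply, h1, sub_zero] at h2
  have h3 : S.HasEigenvector z x := Module.End.hasEigenvector_iff.2
    ⟨Module.End.mem_eigenspace_iff.2 h2, hx.2⟩
  refine lt_of_le_of_ne (hS.norm_eigenvalue_le (Module.End.hasEigenvalue_of_hasEigenvector h3))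
    fun hz1 => ?_
  have h4 : x ∈ S.maxGenEigenspace z := by
    rw [Module.End.mem_maxGenEigenspace]
    exact ⟨1, by simp [h2]⟩
  rw [asymptoticPart_apply_of_norm_eq_one hz1 h4] at h1
  exact smul_ne_zero hz0 hx.2 h1

theorem WeaklyPowerBounded.sub_asymptoticPart {S : Module.End ℂ E} (hS : WeaklyPowerBounded S)
    (φ : Module.End ℂ E →ₗ[ℂ] ℂ) : ∃ M, ∀ k : ℕ, ‖φ ((S - asymptoticPart S) ^ k)‖ ≤ M := by
  obtain ⟨M, hM⟩ := hS φ
  set M' := ∑ z ∈ (finite_peripheral S).toFinset, ‖φ (spectralProjector S z)‖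
  have hM' : 0 ≤ M' := Finset.sum_nonneg fun _ _ => norm_nonneg _
  refine ⟨M + M', fun k => ?_⟩
  rcases eq_or_ne k 0 with rfl | hk
  · have := hM 0
    rw [pow_zero] at this ⊢
    linarith
  · have h1 := pow_eq_add_pow hS.sub_mul_asymptoticPart hS.asymptoticPart_mul_sub hk
    rw [← sub_eq_iff_eq_add] at h1
    rw [← h1, map_sub]
    refine (norm_sub_le _ _).trans (add_le_add (hM k) ?_)
    rw [asymptoticPart_pow S hk, peripheralSum, map_sum]
    refine (norm_sum_le _ _).trans (Finset.sum_le_sum fun z hz => ?_)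
    rw [map_smul, norm_smul, norm_pow, ((finite_peripheral S).mem_toFinset.1 hz).2]
    simp

/-- The powers of the asymptotic part are limits of powers of the operator, so they satisfy the same
bound. -/
theorem WeaklyPowerBounded.seminorm_asymptoticPart_pow_le {S : Module.End ℂ E}
    (hS : WeaklyPowerBounded S) (p : Seminorm ℝ (Module.End ℂ E)) {C : ℝ}
    (hC : ∀ k : ℕ, p (S ^ k) ≤ C) (k : ℕ) : p (asymptoticPart S ^ k) ≤ C := by
  rcases eq_or_ne k 0 with rfl | hk
  · simpa using hC 0
  set Z := (finite_peripheral S).toFinset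
  have hcirc : ∀ z : Z, (z : ℂ) ∈ Submonoid.unitSphere ℂ := fun z =>
    mem_sphere_zero_iff_norm.2 ((finite_peripheral S).mem_toFinset.1 z.2).2
  let u : Z → Circle := fun z => ⟨z, hcirc z⟩
  -- Recurrence in a compact group: powers of a point of the torus cluster at the identity.
  have hcl : MapClusterPt 1 atTop (fun j : ℕ => u ^ j) := mapClusterPt_one_atTop_pow u
  let D : (Z → Circle) → Module.End ℂ E := fun v =>
    ∑ z : Z, ((z : ℂ) ^ k * ((v z : ℂ) - 1)) • spectralProjector S z
  have hD : Tendsto (fun v => p (D v)) (𝓝 1) (𝓝 0) := by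
    refine tendsto_seminorm_zero p fun φ => ?_
    have hcont : Continuous fun v : Z → Circle => φ (D v) := by
      simp only [D, map_sum, map_smul, smul_eq_mul]
      fun_prop
    have := hcont.tendsto 1
    simpa [D] using this
  have hA : Tendsto (fun j : ℕ => p ((S - asymptoticPart S) ^ j)) atTop (𝓝 0) := by
    refine tendsto_seminorm_zero p fun φ => ?_
    obtain ⟨M, hM⟩ := hS.sub_asymptoticPart φ
    exact tendsto_orbit_zero _ (fun z => hS.norm_eigenvalue_sub_lt) φ hM
  have hpow : ∀ j, asymptoticPart S ^ (k + j) - asymptoticPart S ^ k = D (u ^ j) := fun j => by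
    rw [asymptoticPart_pow S hk, asymptoticPart_pow S (by omega), peripheralSum, peripheralSum,
      ← Finset.sum_sub_distrib, ← Finset.sum_coe_sort]
    refine Finset.sum_congr rfl fun z _ => ?_
    have hu : (((u ^ j) z : Circle) : ℂ) = (z : ℂ) ^ j := rfl
    rw [← sub_smul, pow_add, hu, mul_sub, mul_one]
  refine le_of_forall_pos_le_add fun ε hε => ?_
  have h1 : ∃ᶠ j in atTop, p (D (u ^ j)) < ε / 2 :=
    hcl.frequently (hD.eventually_lt_const (by linarith))
  have h2 : ∀ᶠ j in atTop, p ((S - asymptoticPart S) ^ (k + j)) < ε / 2 :=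
    ((hA.comp (tendsto_add_atTop_nat k)).eventually_lt_const (half_pos hε)).mono fun j hj => by
      rwa [Function.comp_apply, add_comm j k] at hj
  obtain ⟨j, hj1, hj2⟩ := (h1.and_eventually h2).exists
  have h3 := pow_eq_add_pow hS.sub_mul_asymptoticPart hS.asymptoticPart_mul_sub
    (show k + j ≠ 0 by omega)
  -- Both corrections to `S ^ (k + j)` are small for a suitable `j`: the middle one eventually, the
  -- last one frequently.
  have h4 : asymptoticPart S ^ k = S ^ (k + j) - (S - asymptoticPart S) ^ (k + j) - D (u ^ j) := by
    rw [h3, ← hpow]; abel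
  rw [h4]
  have h5 := map_sub_le_add p (S ^ (k + j) - (S - asymptoticPart S) ^ (k + j)) (D (u ^ j))
  have h6 := map_sub_le_add p (S ^ (k + j)) ((S - asymptoticPart S) ^ (k + j))
  linarith [hC (k + j)]

end Operator

/-- The bound on `T ^ n - T' ^ n`, where `T'` is annihilated by `T - T'` from both sides. -/
theorem seminorm_pow_sub_pow_le_factorwiseBound {𝕜 W : Type*} [RCLike 𝕜] [NormedAlgebra 𝕜 ℂ]
    [AddCommGroup W] [Module 𝕜 W] [FiniteDimensional 𝕜 W] (N : Seminorm 𝕜 (Module.End 𝕜 W))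
    {T T' A : Module.End 𝕜 W} {C μ : ℝ} (hT : ∀ k : ℕ, N (T ^ k) ≤ C)
    (hT' : ∀ k : ℕ, N (T' ^ k) ≤ C) (hA : A = T - T') (h1 : (T - T') * T' = 0)
    (h2 : T' * (T - T') = 0) {m : ℂ[X]} (hm : m = (minpoly 𝕜 A).map (algebraMap 𝕜 ℂ))
    (hμ0 : μ ≠ 0 ∨ A = 0) (hμ1 : μ < 1)
    (hroots : ∀ z ∈ m.roots, ‖z‖ ≤ μ) {lamD : ℂ} (hlam : lamD ∈ m.roots) (hlamμ : ‖lamD‖ = μ)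
    {n : ℕ} (hn : μ / (1 - μ) < n) : N (T ^ n - T' ^ n) ≤ factorwiseBound C μ m lamD n := by
  have hμ : 0 ≤ μ := hlamμ ▸ norm_nonneg lamD
  have hn0 : n ≠ 0 := by
    rintro rfl
    exact absurd hn (by simpa using div_nonneg hμ (by linarith))
  have hsub : T ^ n - T' ^ n = A ^ n := by
    rw [pow_eq_add_pow h1 h2 hn0, hA, add_sub_cancel_right]
  rw [hsub]
  -- If `μ = 0`, then `A = 0` and, since `n ≠ 0`, both sides vanish.
  rcases hμ.eq_or_lt with rfl | hμpos
  · rw [hμ0.resolve_left (by simp), zero_pow hn0, map_zero, factorwiseBound, zero_pow hn0]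
    simp
  · refine seminorm_pow_le_factorwiseBound N A (fun k => ?_) hm hμpos hμ1 hroots hlam hlamμ hn
    have hC : 0 ≤ C := (apply_nonneg N _).trans (hT 0)
    -- The splitting of powers fails at `k = 0`, where `A ^ 0 = T ^ 0` already has norm at most `C ≤
    -- 2 C`.
    rcases eq_or_ne k 0 with rfl | hk
    · have := hT 0
      rw [pow_zero] at this ⊢
      linarith
    · have h3 : A ^ k = T ^ k - T' ^ k := by
        rw [pow_eq_add_pow h1 h2 hk, hA, add_sub_cancel_right]
      rw [h3]
      linarith [map_sub_le_add N (T ^ k) (T' ^ k), hT k, hT' k]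

theorem norm_le_spectralRadius_toReal {R : Type*} [Ring R] [Algebra ℂ R] {a : R}
    (h : ∀ z ∈ spectrum ℂ a, ‖z‖ ≤ 1) {z : ℂ} (hz : z ∈ spectrum ℂ a) :
    ‖z‖ ≤ (spectralRadius ℂ a).toReal := by
  -- Finiteness is needed because `toReal` sends `⊤` to `0`.
  have h1 : spectralRadius ℂ a ≤ 1 := iSup₂_le fun w hw => by
    exact_mod_cast (show ‖w‖₊ ≤ 1 from h w hw)
  have h2 : (‖z‖₊ : ENNReal) ≤ spectralRadius ℂ a :=
    le_iSup₂ (f := fun (w : ℂ) (_ : w ∈ spectrum ℂ a) => (‖w‖₊ : ENNReal)) z hz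
  exact ENNReal.toReal_mono (ne_top_of_le_ne_top ENNReal.one_ne_top h1) h2

/-! ### Complexification of real operators. -/

section Real

variable {V : Type*} [AddCommGroup V] [Module ℝ V]

/-- The real part of an operator on the complexification. -/
def realPartEnd (V : Type*) [AddCommGroup V] [Module ℝ V] :
    Module.End ℂ (ℂ ⊗[ℝ] V) →ₗ[ℝ] Module.End ℝ V where
  toFun X := rePart V ∘ₗ X.restrictScalars ℝ ∘ₗ TensorProduct.mk ℝ ℂ V 1
  map_add' X Y := by ext v; simp
  map_smul' c X := by ext v; simp

theorem realPartEnd_complexify (T : Module.End ℝ V) : realPartEnd V (complexify T) = T := by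
  ext v
  simp [realPartEnd, complexify, rePart]

theorem complexify_injective : Function.Injective (complexify (V := V)) :=
  Function.LeftInverse.injective realPartEnd_complexify

theorem complexify_pow (T : Module.End ℝ V) (k : ℕ) : complexify (T ^ k) = complexify T ^ k :=
  LinearMap.baseChange_pow _ _ _ T k

theorem complexify_mul (S T : Module.End ℝ V) :
    complexify (S * T) = complexify S * complexify T := LinearMap.baseChange_mul S T

theorem complexify_sub (S T : Module.End ℝ V) :
    complexify (S - T) = complexify S - complexify T := LinearMap.baseChange_sub S T

/-- The real minimal polynomial annihilates the complexification, and it divides the characteristic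
polynomial, which commutes with base change. Equality of the two minimal polynomials is not needed.
-/
theorem hasEigenvalue_complexify_iff [FiniteDimensional ℝ V] (A : Module.End ℝ V) (z : ℂ) :
    (complexify A).HasEigenvalue z ↔ z ∈ ((minpoly ℝ A).map (algebraMap ℝ ℂ)).roots := by
  have hm : (minpoly ℝ A).Monic := minpoly.monic (Algebra.IsIntegral.isIntegral A)
  rw [mem_roots (hm.map _).ne_zero]
  constructor
  · intro h
    have h1 : aeval (complexify A) ((minpoly ℝ A).map (algebraMap ℝ ℂ)) = 0 := by
      rw [aeval_map_algebraMap]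
      have : aeval (complexify A) (minpoly ℝ A)
          = Module.End.baseChangeHom ℝ ℂ V (aeval A (minpoly ℝ A)) := by
        rw [← Polynomial.aeval_algHom_apply]; rfl
      rw [this, minpoly.aeval, map_zero]
    exact (Module.End.hasEigenvalue_iff_isRoot.1 h).dvd (minpoly.dvd ℂ _ h1)
  · intro h
    rw [Module.End.hasEigenvalue_iff_isRoot_charpoly, complexify, LinearMap.charpoly_baseChange]
    exact h.dvd (Polynomial.map_dvd _ (LinearMap.minpoly_dvd_charpoly A))

end Real

end

/-! ### The complex and real cases. -/

section

theorem factorwiseBound_of_complex {V : Type*} [AddCommGroup V] [Module ℂ V]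
    [FiniteDimensional ℂ V] (N : Seminorm ℂ (Module.End ℂ V)) (hN : ∀ X, N X = 0 → X = 0)
    {T A : Module.End ℂ V} {C : ℝ} (hC : ∀ k : ℕ, N (T ^ k) ≤ C) (hA : A = T - asymptoticPart T)
    {μ : ℝ} (hμ : μ = (spectralRadius ℂ A).toReal) (hμ0 : μ ≠ 0 ∨ A = 0) {lamD : ℂ}
    (hlam : lamD ∈ spectrum ℂ A) (hlamμ : ‖lamD‖ = μ) {n : ℕ} (hn : (n : ℝ) > μ / (1 - μ)) :
    N (T ^ n - asymptoticPart T ^ n) ≤ factorwiseBound C μ (minpoly ℂ A) lamD n := by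
  have hS : WeaklyPowerBounded T := fun φ => by
    obtain ⟨M, hM0, hM⟩ := exists_norm_le_mul_seminorm N hN φ
    exact ⟨M * C, fun k => (hM _).trans (mul_le_mul_of_nonneg_left (hC k) hM0)⟩
  have hlt : ∀ z ∈ spectrum ℂ A, ‖z‖ < 1 := fun z hz =>
    hS.norm_eigenvalue_sub_lt (hA ▸ Module.End.hasEigenvalue_iff_mem_spectrum.2 hz)
  have hroots : ∀ z, z ∈ (minpoly ℂ A).roots ↔ z ∈ spectrum ℂ A := fun z => by
    rw [mem_roots (minpoly.ne_zero (Algebra.IsIntegral.isIntegral A)),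
      ← Module.End.hasEigenvalue_iff_isRoot, Module.End.hasEigenvalue_iff_mem_spectrum]
  exact seminorm_pow_sub_pow_le_factorwiseBound N hC
    (hS.seminorm_asymptoticPart_pow_le (N.restrictScalars ℝ) hC) hA
    hS.sub_mul_asymptoticPart hS.asymptoticPart_mul_sub (by simp) hμ0 (hlamμ ▸ hlt _ hlam)
    (fun z hz => hμ ▸ norm_le_spectralRadius_toReal (fun w hw => (hlt w hw).le)
      ((hroots z).1 hz)) ((hroots lamD).2 hlam) hlamμ hn

theorem factorwiseBound_of_real {V : Type*} [AddCommGroup V] [Module ℝ V]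
    [FiniteDimensional ℝ V] (N : Seminorm ℝ (Module.End ℝ V)) (hN : ∀ X, N X = 0 → X = 0)
    {T A : Module.End ℝ V} {C : ℝ} (hC : ∀ k : ℕ, N (T ^ k) ≤ C)
    (hA : A = T - realAsymptoticPart T) {μ : ℝ}
    (hμ : μ = (spectralRadius ℂ (complexify A)).toReal) (hμ0 : μ ≠ 0 ∨ A = 0) {lamD : ℂ}
    (hlam : lamD ∈ spectrum ℂ (complexify A)) (hlamμ : ‖lamD‖ = μ) {n : ℕ}
    (hn : (n : ℝ) > μ / (1 - μ)) :
    N (T ^ n - realAsymptoticPart T ^ n)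
      ≤ factorwiseBound C μ ((minpoly ℝ A).map (algebraMap ℝ ℂ)) lamD n := by
  -- Composed with base change, a complex functional becomes real-linear on `Module.End ℝ V`, where
  -- `N` controls it; no norm on the complexified endomorphisms is chosen.
  have hS : WeaklyPowerBounded (complexify T) := fun φ => by
    obtain ⟨M, hM0, hM⟩ := exists_norm_le_mul_seminorm N hN
      (φ.restrictScalars ℝ ∘ₗ LinearMap.baseChangeHom ℝ ℂ V V)
    refine ⟨M * C, fun k => ?_⟩
    rw [← complexify_pow]
    exact (hM _).trans (mul_le_mul_of_nonneg_left (hC k) hM0)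
  have hAc : complexify A = complexify T - asymptoticPart (complexify T) := by
    rw [hA, complexify_sub, complexify_realAsymptoticPart]
  have hlt : ∀ z ∈ spectrum ℂ (complexify A), ‖z‖ < 1 := fun z hz =>
    hS.norm_eigenvalue_sub_lt (hAc ▸ Module.End.hasEigenvalue_iff_mem_spectrum.2 hz)
  have hroots : ∀ z, z ∈ ((minpoly ℝ A).map (algebraMap ℝ ℂ)).roots ↔
      z ∈ spectrum ℂ (complexify A) := fun z => by
    rw [← hasEigenvalue_complexify_iff, Module.End.hasEigenvalue_iff_mem_spectrum]
  -- Pulling `N` back along the real part gives only a real, possibly degenerate, seminorm, which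
  -- suffices for the limit argument.
  obtain ⟨p, hp⟩ : ∃ p : Seminorm ℝ (Module.End ℂ (ℂ ⊗[ℝ] V)), ∀ X, p (complexify X) = N X :=
    ⟨N.comp (realPartEnd V), fun X => congrArg N (realPartEnd_complexify X)⟩
  have hT' : ∀ k : ℕ, N (realAsymptoticPart T ^ k) ≤ C := fun k => by
    rw [← hp, complexify_pow, complexify_realAsymptoticPart]
    exact hS.seminorm_asymptoticPart_pow_le p
      (fun k => ((congrArg p (complexify_pow T k)).symm.trans (hp _)).trans_le (hC k)) k
  refine seminorm_pow_sub_pow_le_factorwiseBound N hC hT' hA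
    (complexify_injective ?_) (complexify_injective ?_) rfl hμ0 (hlamμ ▸ hlt _ hlam)
    (fun z hz => hμ ▸ norm_le_spectralRadius_toReal (fun w hw => (hlt w hw).le)
      ((hroots z).1 hz)) ((hroots lamD).2 hlam) hlamμ hn
  · rw [complexify_mul, complexify_sub, complexify_realAsymptoticPart,
      hS.sub_mul_asymptoticPart]
    exact (LinearMap.baseChange_zero).symm
  · rw [complexify_mul, complexify_sub, complexify_realAsymptoticPart,
      hS.asymptoticPart_mul_sub]
    exact (LinearMap.baseChange_zero).symm

end

end PowerBounded

end

/-- First part: complex spaces. Second part: real spaces, where the spectrum and the linear factors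
of the minimal polynomial are taken over the complex numbers. In both, `N` is an arbitrary norm on
the space of endomorphisms, `C` bounds the semigroup generated by `T`, and `A` is the difference of
`T` and its asymptotic part. -/
theorem corollary5 :
    (∀ (V : Type*) [AddCommGroup V] [Module ℂ V] [FiniteDimensional ℂ V]
        (N : Seminorm ℂ (Module.End ℂ V)) (hN : ∀ X, N X = 0 → X = 0)
        (T : Module.End ℂ V) (C : ℝ) (hC : ∀ k : ℕ, N (T ^ k) ≤ C)
        (A : Module.End ℂ V) (hA : A = T - PowerBounded.asymptoticPart T)
        (m : Polynomial ℂ) (hm : m = minpoly ℂ A)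
        (μ : ℝ) (hμ : μ = (spectralRadius ℂ A).toReal) (hμ0 : μ ≠ 0 ∨ A = 0)
        (lamD : ℂ) (hlam : lamD ∈ spectrum ℂ A) (hlamμ : ‖lamD‖ = μ)
        (n : ℕ) (hn : (n : ℝ) > μ / (1 - μ)),
        N (T ^ n - PowerBounded.asymptoticPart T ^ n)
          ≤ PowerBounded.factorwiseBound C μ m lamD n) ∧
    (∀ (V : Type*) [AddCommGroup V] [Module ℝ V] [FiniteDimensional ℝ V]
        (N : Seminorm ℝ (Module.End ℝ V)) (hN : ∀ X, N X = 0 → X = 0)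
        (T : Module.End ℝ V) (C : ℝ) (hC : ∀ k : ℕ, N (T ^ k) ≤ C)
        (A : Module.End ℝ V) (hA : A = T - PowerBounded.realAsymptoticPart T)
        (m : Polynomial ℂ) (hm : m = (minpoly ℝ A).map (algebraMap ℝ ℂ))
        (μ : ℝ) (hμ : μ = (spectralRadius ℂ (PowerBounded.complexify A)).toReal) (hμ0 : μ ≠ 0 ∨ A = 0)
        (lamD : ℂ) (hlam : lamD ∈ spectrum ℂ (PowerBounded.complexify A)) (hlamμ : ‖lamD‖ = μ)
        (n : ℕ) (hn : (n : ℝ) > μ / (1 - μ)),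
        N (T ^ n - PowerBounded.realAsymptoticPart T ^ n)
          ≤ PowerBounded.factorwiseBound C μ m lamD n) := by
  refine ⟨?_, ?_⟩
  · intro V _ _ _ N hN T C hC A hA m hm μ hμ hμ0 lamD hlam hlamμ n hn
    subst hm
    exact PowerBounded.factorwiseBound_of_complex N hN hC hA hμ hμ0 hlam hlamμ hn
  · intro V _ _ _ N hN T C hC A hA m hm μ hμ hμ0 lamD hlam hlamμ n hn
    subst hm
    exact PowerBounded.factorwiseBound_of_real N hN hC hA hμ hμ0 hlam hlamμ hn
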